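/- **Theorem (purity).** Let $\mathsf A$ be a finite automaton: a finite vertex set $V$, a finite set of labelled edges $i\xrightarrow{a}j$ with $i,j\in V$, $a\in\mathbb Z$ (parallel edges carry different labels), and nonempty sets $I,T\subseteq V$ of initial and terminal states. Let $M_a$ be the $0$–$1$ matrix with $(M_a)_{ij}=1$ iff there is an edge $i\xrightarrow{a}j$, and assume that $M=\sum_a M_a$ is primitive. Let $\lambda>0$ be its Perron–Frobenius eigenvalue and $\mathbf v_L,\mathbf v_R$ positive left and right eigenvectors for $\lambda$ with $\mathbf v_L^{\mathsf T}\mathbf v_R=1$. Let $K^+$ be the set of label sequences $(x_k)_{k\ge1}$ of infinite paths, and $K_I^+$ the set of label sequences of infinite paths that start in $I$. An accepting path is a nonempty finite path from $I$ to $T$. For a word $w$, $[w]$ denotes the cylinder of sequences beginning with $w$. (a) There is a unique Borel measure $\mu^+$ on $K^+$ with $\mu^+([\varepsilon_1,\dots,\varepsilon_k])=\lambda^{-k}\,\mathbf v_L^{\mathsf T}M_{\varepsilon_1}\cdots M_{\varepsilon_k}\mathbf v_R$ for all words (the Parry measure), and a unique Borel measure $\mu_I^+$ on $K_I^+$ such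 that, for all words $w$, $$\mu_I^+([w])=\lim_{n\to\infty}\frac{\#\{\text{accepting paths of length } n \text{ whose label begins with } w\}}{\#\{\text{accepting paths of length } n\}}.$$ If every word is the label of at most one accepting path, then also $\mu_I^+([w])=\lim_{n\to\infty}\#\{u\in\mathcal L_n: u \text{ begins with } w\}/\#\mathcal L_n$, where $\mathcal L_n$ is the set of words of length $n$ that label an accepting path. (b) Let $\beta$ be a Pisot number, i.e. a real algebraic integer $\beta>1$ all of whose other conjugates have modulus $<1$ (integers $\ge2$ included), and let $\phi_I^+$ and $\phi^+$ be the maps $x\mapsto\sum_{k\ge1}x_k\beta^{-k}$ on $K_I^+$ and $K^+$. Then the push-forwards $\nu_I=(\phi_I^+)_*(\mu_I^+)$ and $\nu=(\phi^+)_*(\mu^+)$ are probability measures on $\mathbb R$, and each of them is pure: it is absolutely continuous with respect to Lebesgue measure, or purely singular continuous, or purely atomic. (c) If $\nu$ or $\nu_I$ is purely atomic, then $\phi^+(K^+)$ is finite, and the number of atoms of that measure is at most $\#V$. -/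

import Mathlib

open MeasureTheory Filter Topology

noncomputable section

/-- A finite automaton over an integer alphabet: a finite set of labelled edges
`(i, a, j)` (an edge from `i` to `j` with label `a`), a set `init` of initial states and
a set `term` of terminal states. Parallel edges must carry different labels. -/
structure DigitAutomaton (V : Type*) where
  edges : Finset (V × ℤ × V)
  init : Set V
  term : Set V

namespace DigitAutomaton

variable {V : Type*} (A : DigitAutomaton V)

/-- The initial vertex of an edge. -/
def src (e : V × ℤ × V) : V := e.1

/-- The label of an edge. -/
def lab (e : V × ℤ × V) : ℤ := e.2.1

/-- The terminal vertex of an edge. -/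
def tgt (e : V × ℤ × V) : V := e.2.2

/-- The labels occurring in the automaton. -/
def alphabet : Finset ℤ := A.edges.image lab

/-! ### Paths, language and shift spaces -/

/-- A (finite) path: a list of edges, each ending where the next one begins. -/
def IsPath (p : List (V × ℤ × V)) : Prop :=
  (∀ e ∈ p, e ∈ A.edges) ∧ p.IsChain (fun e f => tgt e = src f)

/-- A nonempty path that starts in an initial and ends in a terminal state. -/
def IsAcceptingPath (p : List (V × ℤ × V)) : Prop :=
  A.IsPath p ∧ (∃ e ∈ p.head?, src e ∈ A.init) ∧ (∃ e ∈ p.getLast?, tgt e ∈ A.term)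

/-- The language recognised by the automaton (it contains the empty word by convention). -/
def language : Set (List ℤ) :=
  {[]} ∪ {u | ∃ p, A.IsAcceptingPath p ∧ p.map lab = u}

/-- Every nonempty word is the label of at most one accepting path. -/
def Unambiguous : Prop :=
  ∀ p q, A.IsAcceptingPath p → A.IsAcceptingPath q → p.map lab = q.map lab → p = q

/-- The number of words of length `n` in the language that begin with `w`. -/
def wordCount (w : List ℤ) (n : ℕ) : ℕ :=
  {u | u ∈ A.language ∧ u.length = n ∧ w <+: u}.ncard

/-- The number of accepting paths of length `n` whose label begins with `w`, i.e. the number of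
words of length `n` in the language that begin with `w`, each counted with the number of
accepting paths by which it is recognised. -/
def pathCount (w : List ℤ) (n : ℕ) : ℕ :=
  {p | A.IsAcceptingPath p ∧ p.length = n ∧ w <+: p.map lab}.ncard

/-- An infinite path. -/
def IsInfinitePath (e : ℕ → V × ℤ × V) : Prop :=
  ∀ k, e k ∈ A.edges ∧ tgt (e k) = src (e (k + 1))

/-- The one-sided sofic shift `K⁺`. Sequences are indexed from `0`. -/
def shift : Set (ℕ → ℤ) :=
  {x | ∃ e, A.IsInfinitePath e ∧ ∀ k, x k = lab (e k)}

/-- The set `K_I⁺` of label sequences of infinite paths starting in an initial state. -/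
def shiftInit : Set (ℕ → ℤ) :=
  {x | ∃ e, A.IsInfinitePath e ∧ src (e 0) ∈ A.init ∧ ∀ k, x k = lab (e k)}

/-- The cylinder of all points of `K` that begin with the word `w`. -/
def cylinder (K : Set (ℕ → ℤ)) (w : List ℤ) : Set K :=
  {x | ∀ k : Fin w.length, x.1 k = w.get k}

/-! ### Transition matrices and Perron–Frobenius data -/

open Classical in
/-- The `a`-transition matrix. -/
def labelMatrix (a : ℤ) : Matrix V V ℝ :=
  Matrix.of fun i j => if (i, a, j) ∈ A.edges then 1 else 0

/-- The transition matrix `M`, the sum of the `a`-transition matrices. -/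
def transitionMatrix : Matrix V V ℝ := ∑ a ∈ A.alphabet, A.labelMatrix a

/-- The product of the transition matrices along a word. -/
def wordMatrix [Fintype V] [DecidableEq V] (w : List ℤ) : Matrix V V ℝ :=
  (w.map A.labelMatrix).prod

/-- `lam` is the Perron–Frobenius eigenvalue of the transition matrix, `vL` and `vR` are positive
left and right eigenvectors for it, normalised by `vL ⬝ vR = 1`. -/
structure IsPerron [Fintype V] (lam : ℝ) (vL vR : V → ℝ) : Prop where
  lam_pos : 0 < lam
  left_pos : ∀ i, 0 < vL i
  right_pos : ∀ i, 0 < vR i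
  left_eigen : Matrix.vecMul vL A.transitionMatrix = lam • vL
  right_eigen : Matrix.mulVec A.transitionMatrix vR = lam • vR
  normalised : dotProduct vL vR = 1

/-! ### The measures -/

/-- `μ` is the measure `μ_I⁺` on `K_I⁺`: the mass of the cylinder of `w` is the limiting proportion
of words beginning with `w` among all words of length `n`. -/
def IsInitMeasure (μ : Measure A.shiftInit) : Prop :=
  ∀ w : List ℤ,
    Tendsto (fun n : ℕ => ENNReal.ofReal ((A.pathCount w n : ℝ) / (A.pathCount [] n : ℝ))) atTop
      (𝓝 (μ (cylinder A.shiftInit w)))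

/-- `μ` is the Parry measure `μ⁺` on `K⁺`. -/
def IsParryMeasure [Fintype V] [DecidableEq V] (μ : Measure A.shift) : Prop :=
  ∃ (lam : ℝ) (vL vR : V → ℝ), A.IsPerron lam vL vR ∧
    ∀ w : List ℤ, μ (cylinder A.shift w) =
      ENNReal.ofReal ((lam ^ w.length)⁻¹ * dotProduct vL (Matrix.mulVec (A.wordMatrix w) vR))

end DigitAutomaton

/-- The value `∑ x_k β^{-k}`, `k ≥ 1`, of a digit sequence in a set `K` of digit sequences. -/
def digitMap (β : ℝ) (K : Set (ℕ → ℤ)) (x : K) : ℝ := ∑' k : ℕ, (x.1 k : ℝ) / β ^ (k + 1)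

/-- A Pisot number: a real algebraic integer `β > 1` all of whose other conjugates have
modulus less than one. -/
def IsPisot (β : ℝ) : Prop :=
  1 < β ∧ IsIntegral ℤ β ∧
    ∀ z : ℂ, Polynomial.aeval z (minpoly ℚ β) = 0 → z ≠ (β : ℂ) → ‖z‖ < 1

/-- Singular with respect to Lebesgue measure and without point masses. -/
def IsSingularContinuous (ν : Measure ℝ) : Prop :=
  ν.MutuallySingular volume ∧ ∀ x, ν {x} = 0

/-- Carried by a countable set. -/
def IsPurelyAtomic (ν : Measure ℝ) : Prop :=
  ∃ S : Set ℝ, S.Countable ∧ ν Sᶜ = 0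

/-- The set of atoms. -/
def atoms (ν : Measure ℝ) : Set ℝ := {x | ν {x} ≠ 0}

/-- Absolutely continuous, purely singular continuous, or purely atomic. -/
def IsPure (ν : Measure ℝ) : Prop :=
  ν.AbsolutelyContinuous volume ∨ IsSingularContinuous ν ∨ IsPurelyAtomic ν

end

/-! Give each edge from i to j the probability v_R(j) / (λ v_R(i)). The eigenvector equation makes
this a Markov chain, and along a path the factors telescope. Both measures of (a) are laws of the
label sequence of this chain (`exists_labelProcess`): μ⁺ for the initial distribution v_L(i) v_R(i),
μ_I⁺ for the initial distribution on I proportional to v_R. The second law is the limit of path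
proportions because λ⁻ⁿMⁿ converges to the projection v_R v_Lᵀ (`tendsto_pow_mulVec`,
`tendsto_pathCount_div`). Uniqueness holds because cylinders determine a finite measure.

For (b) and (c) let ν_i be the law of ∑ x_k β^{-k} for the chain started in i. Conditioning on the
first edge expresses ν_i as an average of images of the ν_j under the maps x ↦ (a + x) / β
(`IsSelfSimilar`). Both push-forwards are mixtures of the ν_i, so their type has to be decided for
all i simultaneously.

Self-similar families of finite measures are determined by their masses (`IsSelfSimilar.ext`). If N
is invariant under all these maps, i ↦ ν_i(N) is harmonic, hence a constant c. The restrictions of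
the ν_i to N and the multiples c ν_i are then self-similar with equal masses, so they agree, and
evaluation at N gives c = c² (`zero_or_one`). If some ν_i charges a Lebesgue null set, the
saturation of that set under the countably many affine maps with algebraic coefficients is still
null and is invariant, so it carries every ν_i.

If some ν_i has an atom, an atom of maximal mass is passed on along every edge. There are only
finitely many atoms of that mass, so the points x ↦ βx − a reached along a path stay bounded, which
forces the path to have a value depending only on its first vertex (`exists_value_of_atom`). Then
there are at most #V values in all. Without atoms of the ν_i, the mixtures have none either. -/

namespace Matrix

/-! ### Perron–Frobenius theory of primitive matrices -/

variable {n : Type*} [Fintype n]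

theorem mulVec_pos_of_pos {P : Matrix n n ℝ} (hP : ∀ i j, 0 < P i j) {x : n → ℝ}
    (hx : ∀ i, 0 ≤ x i) (hx0 : x ≠ 0) (i : n) : 0 < (P *ᵥ x) i := by
  obtain ⟨j, hj⟩ := Function.ne_iff.1 hx0
  exact Finset.sum_pos' (fun k _ => mul_nonneg (hP i k).le (hx k))
    ⟨j, Finset.mem_univ _, mul_pos (hP i j) ((hx j).lt_of_ne' hj)⟩

/-- In the sup norm weighted by a positive eigenvector, a nonnegative matrix expands by at most the
eigenvalue. -/
theorem abs_mulVec_le {P : Matrix n n ℝ} (hP : ∀ i j, 0 ≤ P i j) {v y : n → ℝ} {s C : ℝ}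
    (hv : P *ᵥ v = s • v) (hy : ∀ i, |y i| ≤ C * v i) (i : n) :
    |(P *ᵥ y) i| ≤ s * C * v i := by
  have h1 : (P *ᵥ v) i = s * v i := by rw [hv]; rfl
  calc |(P *ᵥ y) i| ≤ ∑ j, |P i j * y j| := Finset.abs_sum_le_sum_abs _ _
    _ ≤ ∑ j, P i j * (C * v j) := by
        refine Finset.sum_le_sum fun j _ => ?_
        rw [abs_mul, abs_of_nonneg (hP i j)]
        exact mul_le_mul_of_nonneg_left (hy j) (hP i j)
    _ = C * (P *ᵥ v) i := by
        simp only [mulVec, dotProduct, Finset.mul_sum]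
        exact Finset.sum_congr rfl fun j _ => by ring
    _ = s * C * v i := by rw [h1]; ring

variable [DecidableEq n]

theorem pow_mulVec_of_eigen {M : Matrix n n ℝ} {r : ℝ} {x : n → ℝ} (h : M *ᵥ x = r • x) (k : ℕ) :
    (M ^ k) *ᵥ x = r ^ k • x := by
  induction k with
  | zero => simp
  | succ k ih => rw [pow_succ, ← mulVec_mulVec, h, mulVec_smul, ih, smul_smul, pow_succ, mul_comm]

theorem vecMul_pow_of_eigen {M : Matrix n n ℝ} {r : ℝ} {x : n → ℝ} (h : x ᵥ* M = r • x) (k : ℕ) :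
    x ᵥ* (M ^ k) = r ^ k • x := by
  induction k with
  | zero => simp
  | succ k ih => rw [pow_succ', ← vecMul_vecMul, h, smul_vecMul, ih, smul_smul, pow_succ, mul_comm]

/-- Existence of a positive eigenvector of a primitive matrix, by maximising the
Collatz–Wielandt quotient. -/
theorem IsPrimitive.exists_pos_eigenvector [Nonempty n] {M : Matrix n n ℝ} (hM : M.IsPrimitive) :
    ∃ r : ℝ, 0 < r ∧ ∃ x : n → ℝ, (∀ i, 0 < x i) ∧ M *ᵥ x = r • x := by
  obtain ⟨hM0, k, hk, hMk⟩ := hM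
  let K : Set (ℝ × (n → ℝ)) :=
    (Set.Icc 0 (∑ i, ∑ j, M i j) ×ˢ stdSimplex ℝ n) ∩ {q | ∀ i, q.1 * q.2 i ≤ (M *ᵥ q.2) i}
  have hKc : IsCompact K := by
    refine (isCompact_Icc.prod (isCompact_stdSimplex ℝ n)).inter_right ?_
    rw [Set.ofPred_forall]
    refine isClosed_iInter fun i => isClosed_le (by fun_prop) ?_
    exact (continuous_apply i).comp (Continuous.matrix_mulVec continuous_const continuous_snd)
  -- The bound on the first coordinate, imposed in `K` for compactness, is automatic, so it does not
  -- obstruct the increase of `r` below.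
  have hbd : ∀ (r : ℝ) (x : n → ℝ), x ∈ stdSimplex ℝ n → (∀ i, r * x i ≤ (M *ᵥ x) i) →
      r ≤ ∑ i, ∑ j, M i j := by
    intro r x hx h
    calc r = ∑ i, r * x i := by rw [← Finset.mul_sum, hx.2, mul_one]
      _ ≤ ∑ i, (M *ᵥ x) i := Finset.sum_le_sum fun i _ => h i
      _ ≤ _ := by
        refine Finset.sum_le_sum fun i _ => Finset.sum_le_sum fun j _ => ?_
        have : x j ≤ 1 := by
          rw [← hx.2]; exact Finset.single_le_sum (fun i _ => hx.1 i) (Finset.mem_univ j)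
        exact mul_le_of_le_one_right (hM0 i j) this
  have hnn : ∀ x : n → ℝ, (∀ i, 0 ≤ x i) → ∀ i, 0 ≤ (M *ᵥ x) i := fun x hx i =>
    Finset.sum_nonneg fun j _ => mul_nonneg (hM0 i j) (hx j)
  obtain ⟨i0⟩ := ‹Nonempty n›
  have hKn : K.Nonempty := by
    refine ⟨(0, Pi.single i0 1), ⟨⟨⟨le_rfl, ?_⟩, single_mem_stdSimplex ℝ i0⟩, ?_⟩⟩
    · exact Finset.sum_nonneg fun i _ => Finset.sum_nonneg fun j _ => hM0 i j
    · intro i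
      simpa using hnn _ (single_mem_stdSimplex ℝ i0).1 i
  obtain ⟨⟨r, x⟩, ⟨⟨hr, hx⟩, hrx⟩, hmax⟩ := hKc.exists_isMaxOn hKn continuous_fst.continuousOn
  simp only [Set.mem_ofPred_eq] at hr hx hrx
  have hx0 : x ≠ 0 := by
    rintro rfl
    simpa using hx.2
  -- Otherwise applying the positive matrix `M ^ k` turns the inequality `r • x ≤ M *ᵥ x` into a
  -- strict one in every coordinate, leaving room for a larger `r`.
  have hev : M *ᵥ x = r • x := by
    by_contra hne
    have hz : ∀ i, 0 < ((M ^ k) *ᵥ (M *ᵥ x - r • x)) i :=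
      mulVec_pos_of_pos hMk (fun i => sub_nonneg.2 (hrx i)) (sub_ne_zero.2 hne)
    have hy : ∀ i, 0 < ((M ^ k) *ᵥ x) i := mulVec_pos_of_pos hMk hx.1 hx0
    set y := (M ^ k) *ᵥ x with hydef
    have hzy : (M ^ k) *ᵥ (M *ᵥ x - r • x) = M *ᵥ y - r • y := by
      rw [mulVec_sub, mulVec_smul, hydef, mulVec_mulVec, mulVec_mulVec, ← pow_succ, ← pow_succ']
    rw [hzy] at hz
    obtain ⟨j, -, hj⟩ := Finset.exists_min_image Finset.univ
      (fun i => (M *ᵥ y - r • y) i / y i) ⟨i0, Finset.mem_univ _⟩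
    set ε := (M *ᵥ y - r • y) j / y j
    have hε : 0 < ε := div_pos (hz j) (hy j)
    have hε' : ∀ i, (r + ε) * y i ≤ (M *ᵥ y) i := fun i => by
      have h := (le_div_iff₀ (hy i)).1 (hj i (Finset.mem_univ i))
      simp only [Pi.sub_apply, Pi.smul_apply, smul_eq_mul] at h
      linarith
    have hS : 0 < ∑ i, y i := Finset.sum_pos (fun i _ => hy i) ⟨i0, Finset.mem_univ _⟩
    have hyS : (∑ i, y i)⁻¹ • y ∈ stdSimplex ℝ n := by
      refine ⟨fun i => mul_nonneg (inv_pos.2 hS).le (hy i).le, ?_⟩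
      simp only [Pi.smul_apply, smul_eq_mul, ← Finset.mul_sum]
      exact inv_mul_cancel₀ hS.ne'
    have hyM : ∀ i, (r + ε) * ((∑ i, y i)⁻¹ • y) i ≤ (M *ᵥ ((∑ i, y i)⁻¹ • y)) i := fun i => by
      rw [mulVec_smul, Pi.smul_apply, Pi.smul_apply, smul_eq_mul, smul_eq_mul, mul_left_comm]
      exact mul_le_mul_of_nonneg_left (hε' i) (inv_pos.2 hS).le
    have := hmax (show (r + ε, (∑ i, y i)⁻¹ • y) ∈ K from
      ⟨⟨⟨by linarith [hr.1], hbd _ _ hyS hyM⟩, hyS⟩, hyM⟩)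
    simp only [Set.mem_ofPred_eq] at this
    linarith
  have hpos : ∀ i, 0 < r ^ k * x i := fun i => by
    have := mulVec_pos_of_pos hMk hx.1 hx0 i
    rwa [pow_mulVec_of_eigen hev] at this
  have hxpos : ∀ i, 0 < x i := fun i => (hx.1 i).lt_of_ne' fun h => by simpa [h] using hpos i
  refine ⟨r, hr.1.lt_of_ne' fun h => ?_, x, hxpos, hev⟩
  simpa [h, hk.ne'] using hpos i0

theorem IsPrimitive.transpose {M : Matrix n n ℝ} (hM : M.IsPrimitive) : Mᵀ.IsPrimitive := by
  obtain ⟨hM0, k, hk, hMk⟩ := hM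
  exact ⟨fun i j => hM0 j i, k, hk, fun i j => by rw [← transpose_pow]; exact hMk j i⟩

/-- The powers of a primitive matrix, normalised by its Perron eigenvalue, converge to the
projection onto the Perron eigenvector. -/
theorem IsPrimitive.tendsto_pow_mulVec {M : Matrix n n ℝ} (hM : M.IsPrimitive) {r : ℝ}
    (hr : 0 < r) {u v : n → ℝ} (hu : ∀ i, 0 < u i) (hv : ∀ i, 0 < v i) (hMu : u ᵥ* M = r • u)
    (hMv : M *ᵥ v = r • v) (huv : u ⬝ᵥ v = 1) (x : n → ℝ) (i : n) :
    Tendsto (fun m : ℕ => (r ^ m)⁻¹ * ((M ^ m) *ᵥ x) i) atTop (𝓝 ((u ⬝ᵥ x) * v i)) := by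
  obtain ⟨hM0, k, hk, hMk⟩ := hM
  -- Doeblin minorisation: `M ^ k` dominates a multiple of the rank-one limit. The remainder `P` is
  -- nonnegative, has eigenvalue `(1 - δ) * r ^ k` at `v`, and agrees with `M ^ k` on vectors
  -- annihilated by `u`, so it contracts them relative to `r ^ k`.
  obtain ⟨δ, hδ0, hδ⟩ : ∃ δ : ℝ, 0 < δ ∧ ∀ i j, δ * (r ^ k * (v i * u j)) ≤ (M ^ k) i j := by
    obtain ⟨q, -, hq⟩ := Finset.exists_min_image (Finset.univ : Finset (n × n))
      (fun q => (M ^ k) q.1 q.2 / (r ^ k * (v q.1 * u q.2))) ⟨(i, i), Finset.mem_univ _⟩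
    have hp : ∀ i j, 0 < r ^ k * (v i * u j) := fun i j =>
      mul_pos (pow_pos hr k) (mul_pos (hv i) (hu j))
    exact ⟨_, div_pos (hMk q.1 q.2) (hp _ _), fun i j =>
      (le_div_iff₀ (hp i j)).1 (hq (i, j) (Finset.mem_univ _))⟩
  let P : Matrix n n ℝ := M ^ k - (δ * r ^ k) • vecMulVec v u
  have hP0 : ∀ i j, 0 ≤ P i j := fun i j => by
    have := hδ i j
    simp only [P, sub_apply, smul_apply, vecMulVec_apply, smul_eq_mul]
    linarith
  have hPy : ∀ y, P *ᵥ y = (M ^ k) *ᵥ y - (δ * r ^ k * (u ⬝ᵥ y)) • v := fun y => by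
    rw [sub_mulVec, smul_mulVec, vecMulVec_mulVec]
    ext j
    simp
    ring
  have hPv : P *ᵥ v = ((1 - δ) * r ^ k) • v := by
    rw [hPy, pow_mulVec_of_eigen hMv, huv]
    ext j
    simp
    ring
  have hδ1 : δ ≤ 1 := by
    have h1 : 0 ≤ (P *ᵥ v) i := Finset.sum_nonneg fun j _ => mul_nonneg (hP0 i j) (hv j).le
    rw [hPv] at h1
    simp only [Pi.smul_apply, smul_eq_mul] at h1
    have h2 := nonneg_of_mul_nonneg_left h1 (hv i)
    have h3 := nonneg_of_mul_nonneg_left h2 (pow_pos hr k)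
    linarith
  have hdot : ∀ (m : ℕ) y, u ⬝ᵥ y = 0 → u ⬝ᵥ ((M ^ m) *ᵥ y) = 0 := fun m y h => by
    rw [dotProduct_mulVec, vecMul_pow_of_eigen hMu, smul_dotProduct, h, smul_zero]
  have hpow : ∀ (i j : n) (m : ℕ), 0 ≤ (M ^ m) i j := fun i j m => by
    induction m generalizing i j with
    | zero => rw [pow_zero, one_apply]; split <;> norm_num
    | succ m ih =>
      rw [pow_succ, mul_apply]
      exact Finset.sum_nonneg fun l _ => mul_nonneg (ih i l) (hM0 l j)
  set y := x - (u ⬝ᵥ x) • v with hy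
  have huy : u ⬝ᵥ y = 0 := by
    rw [hy, dotProduct_sub, dotProduct_smul, huv]
    simp
  obtain ⟨C, hC⟩ : ∃ C : ℝ, ∀ j, |y j| ≤ C * v j := by
    refine ⟨∑ j, |y j| / v j, fun j => ?_⟩
    rw [← div_le_iff₀ (hv j)]
    exact Finset.single_le_sum (f := fun j => |y j| / v j)
      (fun j _ => div_nonneg (abs_nonneg _) (hv j).le) (Finset.mem_univ j)
  have hq : ∀ (q : ℕ) j, |((M ^ (k * q)) *ᵥ y) j| ≤ (((1 - δ) * r ^ k) ^ q * C) * v j := by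
    intro q
    induction q with
    | zero => simpa using hC
    | succ q ih =>
      intro j
      have h1 := abs_mulVec_le hP0 hPv ih j
      rw [hPy, hdot _ _ huy] at h1
      simp only [mul_zero, zero_smul, sub_zero, mulVec_mulVec, ← pow_add] at h1
      rw [mul_add, mul_one, add_comm, pow_succ]
      convert h1 using 1
      ring
  -- Only blocks of length `k` contract; the remaining `m % k` steps cost exactly the factor `r ^ (m
  -- % k)`.
  have hm : ∀ m : ℕ, |(r ^ m)⁻¹ * ((M ^ m) *ᵥ y) i| ≤ (1 - δ) ^ (m / k) * (C * v i) := by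
    intro m
    have h1 := abs_mulVec_le (fun i j => hpow i j (m % k)) (pow_mulVec_of_eigen hMv (m % k))
      (hq (m / k)) i
    have h2 : r ^ m = r ^ (m % k) * (r ^ k) ^ (m / k) := by
      rw [← pow_mul, ← pow_add, Nat.mod_add_div]
    rw [mulVec_mulVec, ← pow_add, Nat.mod_add_div] at h1
    rw [abs_mul, abs_of_pos (inv_pos.2 (pow_pos hr m)), inv_mul_le_iff₀ (pow_pos hr m), h2]
    refine h1.trans_eq ?_
    rw [mul_pow]
    ring
  have hlim : Tendsto (fun m : ℕ => (1 - δ) ^ (m / k) * (C * v i)) atTop (𝓝 0) := by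
    have h1 : Tendsto (fun m : ℕ => (1 - δ) ^ m) atTop (𝓝 0) :=
      tendsto_pow_atTop_nhds_zero_of_lt_one (by linarith) (by linarith)
    simpa using (h1.comp (Nat.tendsto_div_const_atTop hk.ne')).mul_const (C * v i)
  have h0 : Tendsto (fun m : ℕ => (r ^ m)⁻¹ * ((M ^ m) *ᵥ y) i) atTop (𝓝 0) :=
    squeeze_zero_norm hm hlim
  have hx : x = y + (u ⬝ᵥ x) • v := by simp [hy]
  have heq : ∀ m : ℕ, (r ^ m)⁻¹ * ((M ^ m) *ᵥ x) i =
      (r ^ m)⁻¹ * ((M ^ m) *ᵥ y) i + (u ⬝ᵥ x) * v i := fun m => by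
    have hrm : r ^ m ≠ 0 := (pow_pos hr m).ne'
    conv_lhs => rw [hx, mulVec_add, mulVec_smul, pow_mulVec_of_eigen hMv]
    simp only [Pi.add_apply, Pi.smul_apply, smul_eq_mul]
    field_simp
  simp_rw [heq]
  simpa using h0.add_const ((u ⬝ᵥ x) * v i)

end Matrix

namespace DigitAutomaton

variable {V : Type*} (A : DigitAutomaton V)

/-! ### Transition matrices and edges -/

section Edges

variable [DecidableEq V]

/-- The edges that start in a given vertex. -/
def outEdges (i : V) : Finset (V × ℤ × V) := A.edges.filter (src · = i)

@[simp]
theorem mem_outEdges {i : V} {e : V × ℤ × V} : e ∈ A.outEdges i ↔ e ∈ A.edges ∧ src e = i :=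
  Finset.mem_filter

variable [Fintype V]

theorem labelMatrix_mulVec (a : ℤ) (x : V → ℝ) (i : V) :
    (A.labelMatrix a).mulVec x i = ∑ e ∈ A.outEdges i with lab e = a, x (tgt e) := by
  classical
  have h : (A.labelMatrix a).mulVec x i = ∑ j with (i, a, j) ∈ A.edges, x j := by
    simp [Matrix.mulVec, dotProduct, labelMatrix, Finset.sum_filter]
  rw [h]
  refine Finset.sum_bij (fun j _ => (i, a, j)) ?_ ?_ ?_ ?_
  · intro j hj
    rw [Finset.mem_filter, mem_outEdges]
    exact ⟨⟨by simpa using hj, rfl⟩, rfl⟩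
  · simp
  · rintro ⟨k, b, j⟩ he
    rw [Finset.mem_filter, mem_outEdges] at he
    obtain ⟨⟨he, rfl⟩, rfl⟩ := he
    exact ⟨j, Finset.mem_filter.2 ⟨Finset.mem_univ _, he⟩, rfl⟩
  · intros
    rfl

theorem transitionMatrix_mulVec (x : V → ℝ) (i : V) :
    A.transitionMatrix.mulVec x i = ∑ e ∈ A.outEdges i, x (tgt e) := by
  simp only [transitionMatrix, Matrix.sum_mulVec, Finset.sum_apply, labelMatrix_mulVec]
  refine Finset.sum_fiberwise_of_maps_to (fun e he => ?_) _
  exact Finset.mem_image_of_mem _ (A.mem_outEdges.1 he).1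

theorem transitionMatrix_pos_iff {i j : V} :
    0 < A.transitionMatrix i j ↔ ∃ e ∈ A.edges, src e = i ∧ tgt e = j := by
  have h := A.transitionMatrix_mulVec (Pi.single j 1) i
  rw [Matrix.mulVec_single_one, Matrix.col_apply] at h
  simp only [Pi.single_apply, Finset.sum_boole] at h
  rw [h, Nat.cast_pos, Finset.card_pos]
  simp [Finset.Nonempty, and_assoc]

/-- In an automaton with primitive transition matrix, a nonempty set of vertices that is closed
under following edges contains all vertices. -/
theorem mem_of_closed (hM : A.transitionMatrix.IsPrimitive) {S : Set V} (hS : S.Nonempty)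
    (h : ∀ e ∈ A.edges, src e ∈ S → tgt e ∈ S) (j : V) : j ∈ S := by
  obtain ⟨hM0, k, -, hk⟩ := hM
  have key : ∀ (m : ℕ) (i j : V), (A.transitionMatrix ^ m) i j ≠ 0 → i ∈ S → j ∈ S := by
    intro m
    induction m with
    | zero =>
      intro i j hij hi
      obtain rfl : i = j := by
        by_contra hne
        exact hij (by rw [pow_zero, Matrix.one_apply_ne hne])
      exact hi
    | succ m ih =>
      intro i j hij hi
      rw [pow_succ, Matrix.mul_apply] at hij
      obtain ⟨l, -, hl⟩ := Finset.exists_ne_zero_of_sum_ne_zero hij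
      obtain ⟨e, he, rfl, rfl⟩ := A.transitionMatrix_pos_iff.1
        ((hM0 l j).lt_of_ne' (right_ne_zero_of_mul hl))
      exact h e he (ih i _ (left_ne_zero_of_mul hl) hi)
  obtain ⟨i, hi⟩ := hS
  exact key k i j (hk i j).ne' hi

end Edges

/-! ### Counting paths -/

/-- The list `p` is a path from `i` to a terminal state. -/
def IsWalk : V → List (V × ℤ × V) → Prop
  | i, [] => i ∈ A.term
  | i, e :: p => e ∈ A.edges ∧ src e = i ∧ IsWalk (tgt e) p

theorem isWalk_cons_iff (p : List (V × ℤ × V)) (e : V × ℤ × V) (i : V) :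
    A.IsWalk i (e :: p) ↔
      A.IsPath (e :: p) ∧ src e = i ∧ ∃ f ∈ (e :: p).getLast?, tgt f ∈ A.term := by
  induction p generalizing e i with
  | nil => simp [IsWalk, IsPath]
  | cons f p ih =>
    rw [IsWalk, ih]
    simp only [IsPath, List.isChain_cons_cons, List.mem_cons, forall_eq_or_imp,
      List.getLast?_cons_cons]
    constructor
    · rintro ⟨h1, h2, ⟨h3, h4⟩, h5, h6⟩
      exact ⟨⟨⟨h1, h3⟩, h5.symm, h4⟩, h2, h6⟩
    · rintro ⟨⟨⟨h1, h3⟩, h5, h4⟩, h2, h6⟩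
      exact ⟨h1, h2, ⟨h3, h4⟩, h5.symm, h6⟩

theorem isAcceptingPath_iff (p : List (V × ℤ × V)) :
    A.IsAcceptingPath p ↔ p ≠ [] ∧ ∃ i ∈ A.init, A.IsWalk i p := by
  cases p with
  | nil => simp [IsAcceptingPath]
  | cons e p =>
    simp only [IsAcceptingPath, isWalk_cons_iff]
    simp
    tauto

variable [DecidableEq V]

open Classical in
/-- The paths of length `n` from `i` to a terminal state whose label begins with `w`. -/
noncomputable def walks : ℕ → List ℤ → V → Finset (List (V × ℤ × V))
  | 0, w, i => if w = [] ∧ i ∈ A.term then {[]} else ∅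
  | n + 1, w, i => ((A.outEdges i).filter fun e => ∀ a ∈ w.head?, lab e = a).biUnion fun e =>
      (walks n w.tail (tgt e)).image (List.cons e)

theorem mem_walks {n : ℕ} {w : List ℤ} {i : V} {p : List (V × ℤ × V)} :
    p ∈ A.walks n w i ↔ A.IsWalk i p ∧ p.length = n ∧ w <+: p.map lab := by
  induction n generalizing w i p with
  | zero =>
    rw [walks]
    cases p with
    | nil => split_ifs with h <;> simpa [IsWalk, and_comm] using h
    | cons e p => split_ifs <;> simp
  | succ n ih =>
    rw [walks]
    cases p with
    | nil => simp
    | cons e p =>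
      simp only [Finset.mem_biUnion, Finset.mem_filter, mem_outEdges, Finset.mem_image,
        List.cons.injEq]
      constructor
      · rintro ⟨_, ⟨⟨h1, h2⟩, h3⟩, _, h4, rfl, rfl⟩
        obtain ⟨h5, h6, h7⟩ := ih.1 h4
        refine ⟨⟨h1, h2, h5⟩, by simp [h6], ?_⟩
        cases w with
        | nil => simp
        | cons a w =>
          simp only [List.head?_cons, Option.mem_some_iff, forall_eq'] at h3
          simpa [h3] using h7
      · rintro ⟨⟨h1, h2, h5⟩, h6, h7⟩
        refine ⟨e, ⟨⟨h1, h2⟩, ?_⟩, p, ih.2 ⟨h5, by simpa using h6, ?_⟩, rfl, rfl⟩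
        · cases w with
          | nil => simp
          | cons a w => simpa [eq_comm] using (List.cons_prefix_cons.1 h7).1
        · cases w with
          | nil => simp
          | cons a w => exact (List.cons_prefix_cons.1 h7).2

open Classical in
theorem card_walks_succ (n : ℕ) (w : List ℤ) (i : V) :
    (A.walks (n + 1) w i).card =
      ∑ e ∈ (A.outEdges i).filter fun e => ∀ a ∈ w.head?, lab e = a,
        (A.walks n w.tail (tgt e)).card := by
  rw [walks, Finset.card_biUnion]
  · exact Finset.sum_congr rfl fun e _ =>
      Finset.card_image_of_injective _ (List.cons_injective)
  · intro e _ f _ hef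
    rw [Function.onFun, Finset.disjoint_left]
    intro p hp hq
    obtain ⟨_, -, rfl⟩ := Finset.mem_image.1 hp
    obtain ⟨_, -, h⟩ := Finset.mem_image.1 hq
    exact hef (List.cons.inj h).1.symm

variable [Fintype V]

open Classical in
/-- The indicator vector of the set of terminal states. -/
noncomputable def termVec : V → ℝ := fun i => if i ∈ A.term then 1 else 0

theorem card_walks_nil (n : ℕ) (i : V) :
    ((A.walks n [] i).card : ℝ) = ((A.transitionMatrix ^ n).mulVec A.termVec) i := by
  induction n generalizing i with
  | zero => by_cases h : i ∈ A.term <;> simp [walks, termVec, h]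
  | succ n ih =>
    rw [card_walks_succ, pow_succ', ← Matrix.mulVec_mulVec, transitionMatrix_mulVec]
    simp [ih]

/-- The first `w.length` steps must read `w`, and the last `n` are free. -/
theorem card_walks (w : List ℤ) (n : ℕ) (i : V) :
    ((A.walks (w.length + n) w i).card : ℝ) =
      (A.wordMatrix w).mulVec ((A.transitionMatrix ^ n).mulVec A.termVec) i := by
  induction w generalizing i with
  | nil => simpa [wordMatrix] using A.card_walks_nil n i
  | cons a w ih =>
    rw [List.length_cons, add_right_comm, card_walks_succ]
    simp only [wordMatrix, List.map_cons, List.prod_cons, List.tail_cons] at ih ⊢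
    rw [← Matrix.mulVec_mulVec, labelMatrix_mulVec]
    simp [ih]

open Classical in
-- Length zero is excluded because the empty walk is not an accepting path and does not determine
-- its initial vertex.
theorem pathCount_eq (w : List ℤ) {n : ℕ} (hn : n ≠ 0) :
    A.pathCount w n = ∑ i with i ∈ A.init, (A.walks n w i).card := by
  rw [← Finset.card_biUnion, pathCount, ← Set.ncard_coe_finset]
  · congr 1
    ext p
    simp only [Set.mem_ofPred_eq, isAcceptingPath_iff, Finset.coe_biUnion, Finset.coe_filter,
      Finset.mem_univ, true_and, Set.mem_iUnion, Finset.mem_coe, mem_walks]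
    constructor
    · rintro ⟨⟨-, i, hi, h⟩, h2⟩
      exact ⟨i, hi, h, h2⟩
    · rintro ⟨i, hi, h, h2⟩
      refine ⟨⟨?_, i, hi, h⟩, h2⟩
      rintro rfl
      exact hn (by simpa using h2.1.symm)
  · intro i _ j _ hij
    refine Finset.disjoint_left.2 fun p hp hq => ?_
    rw [mem_walks] at hp hq
    cases p with
    | nil => exact hn (by simpa using hp.2.1.symm)
    | cons e p => exact hij (hp.1.2.1.symm.trans hq.1.2.1)

omit [DecidableEq V] [Fintype V] in
theorem wordCount_eq_pathCount (hA : A.Unambiguous) (w : List ℤ) {n : ℕ} (hn : n ≠ 0) :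
    A.wordCount w n = A.pathCount w n := by
  rw [wordCount, pathCount, ← Set.InjOn.ncard_image (f := List.map lab)]
  · congr 1
    ext u
    simp only [Set.mem_ofPred_eq, Set.mem_image, language, Set.mem_union, Set.mem_singleton_iff]
    constructor
    · rintro ⟨rfl | ⟨p, hp, rfl⟩, h1, h2⟩
      · exact absurd h1.symm (by simpa using hn)
      · exact ⟨p, ⟨hp, by simpa using h1, h2⟩, rfl⟩
    · rintro ⟨p, ⟨hp, h1, h2⟩, rfl⟩
      exact ⟨Or.inr ⟨p, hp, rfl⟩, by simpa using h1, h2⟩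
  · exact fun p hp q hq h => hA p q hp.1 hq.1 h

variable {A}

open Classical in
/-- The proportion of accepting paths whose label begins with a given word converges. -/
theorem tendsto_pathCount_div (hI : A.init.Nonempty) (hT : A.term.Nonempty)
    (hM : A.transitionMatrix.IsPrimitive) {lam : ℝ} {vL vR : V → ℝ} (hP : A.IsPerron lam vL vR)
    (w : List ℤ) :
    Tendsto (fun n => (A.pathCount w n : ℝ) / A.pathCount [] n) atTop
      (𝓝 ((lam ^ w.length)⁻¹ * ∑ i with i ∈ A.init, (A.wordMatrix w).mulVec vR i /
        ∑ i with i ∈ A.init, vR i)) := by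
  have hlam := hP.lam_pos
  have hlim : ∀ i, Tendsto (fun n : ℕ => (lam ^ n)⁻¹ *
      (A.transitionMatrix ^ n).mulVec A.termVec i) atTop
      (𝓝 (dotProduct vL A.termVec * vR i)) :=
    hM.tendsto_pow_mulVec hlam hP.left_pos hP.right_pos hP.left_eigen hP.right_eigen
      hP.normalised A.termVec
  set τ := dotProduct vL A.termVec
  have hτ : 0 < τ := by
    obtain ⟨t, ht⟩ := hT
    refine Finset.sum_pos' (fun i _ => mul_nonneg (hP.left_pos i).le ?_)
      ⟨t, Finset.mem_univ _, mul_pos (hP.left_pos t) (by simp [termVec, ht])⟩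
    unfold termVec
    split_ifs <;> norm_num
  have hvI : 0 < ∑ i with i ∈ A.init, vR i := by
    obtain ⟨i, hi⟩ := hI
    exact Finset.sum_pos (fun i _ => hP.right_pos i) ⟨i, by simpa using hi⟩
  set k := w.length with hk
  -- Paths of length `n + k` are counted. The numerator has only `n` free steps, so both counts are
  -- scaled by `lam ^ n`; this leaves the factor `lam ^ k` in the denominator. The common factor `τ`
  -- cancels.
  have h1 : Tendsto (fun n : ℕ => ∑ i with i ∈ A.init, (A.wordMatrix w).mulVec
      ((lam ^ n)⁻¹ • (A.transitionMatrix ^ n).mulVec A.termVec) i) atTop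
      (𝓝 (∑ i with i ∈ A.init, (A.wordMatrix w).mulVec (τ • vR) i)) := by
    have h := tendsto_pi_nhds.2 hlim
    have hc : Continuous fun x : V → ℝ => ∑ i with i ∈ A.init, (A.wordMatrix w).mulVec x i :=
      continuous_finsetSum _ fun i _ =>
        (continuous_apply i).comp (Continuous.matrix_mulVec continuous_const continuous_id)
    exact (hc.tendsto _).comp h
  have h2 : Tendsto (fun n : ℕ => lam ^ k * ∑ i with i ∈ A.init, (lam ^ (n + k))⁻¹ *
      (A.transitionMatrix ^ (n + k)).mulVec A.termVec i) atTop
      (𝓝 (lam ^ k * ∑ i with i ∈ A.init, τ * vR i)) :=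
    ((tendsto_finsetSum _ fun i _ => hlim i).comp (tendsto_add_atTop_nat k)).const_mul _
  rw [← tendsto_add_atTop_iff_nat k]
  have hne : lam ^ k * ∑ i with i ∈ A.init, τ * vR i ≠ 0 := by
    rw [← Finset.mul_sum]
    positivity
  have h3 := h1.div h2 hne
  have hval : (∑ i with i ∈ A.init, (A.wordMatrix w).mulVec (τ • vR) i) /
      (lam ^ k * ∑ i with i ∈ A.init, τ * vR i) =
      (lam ^ k)⁻¹ * ∑ i with i ∈ A.init, (A.wordMatrix w).mulVec vR i /
        ∑ i with i ∈ A.init, vR i := by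
    simp only [Matrix.mulVec_smul, Pi.smul_apply, smul_eq_mul, ← Finset.mul_sum,
      ← Finset.sum_div]
    field_simp
  rw [hval] at h3
  refine h3.congr' ?_
  filter_upwards [eventually_ne_atTop 0] with n hn
  have hnk : n + k ≠ 0 := by omega
  rw [pathCount_eq _ _ hnk, pathCount_eq _ _ hnk, Nat.cast_sum, Nat.cast_sum]
  simp only [Pi.div_apply, card_walks_nil]
  simp only [add_comm n, hk, card_walks, Matrix.mulVec_smul, Pi.smul_apply, smul_eq_mul,
    ← Finset.mul_sum, pow_add]
  rw [mul_inv]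
  field_simp

end DigitAutomaton

/-! ### Cylinder sets of integer sequences -/

/-- The sequences of integers that begin with the word `w`. -/
def wordSet (w : List ℤ) : Set (ℕ → ℤ) := {x | ∀ k : Fin w.length, x k = w.get k}

theorem mem_wordSet {w : List ℤ} {x : ℕ → ℤ} :
    x ∈ wordSet w ↔ ∀ (k : ℕ) (h : k < w.length), x k = w[k] :=
  ⟨fun hx k h => hx ⟨k, h⟩, fun hx k => hx k k.2⟩

@[simp]
theorem wordSet_nil : wordSet [] = Set.univ :=
  Set.eq_univ_of_forall fun _ => mem_wordSet.2 fun _ h => absurd h (Nat.not_lt_zero _)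

theorem mem_wordSet_cons {a : ℤ} {w : List ℤ} {x : ℕ → ℤ} :
    x ∈ wordSet (a :: w) ↔ x 0 = a ∧ (fun k => x (k + 1)) ∈ wordSet w := by
  simp only [mem_wordSet]
  constructor
  · exact fun h => ⟨h 0 (by simp), fun k hk => h (k + 1) (by simpa using hk)⟩
  · rintro ⟨h0, h⟩ (_ | k) hk
    · exact h0
    · exact h k (by simpa using hk)

theorem measurableSet_wordSet (w : List ℤ) : MeasurableSet (wordSet w) := by
  rw [wordSet, Set.ofPred_forall]
  exact MeasurableSet.iInter fun k => (measurable_pi_apply (X := fun _ : ℕ => ℤ) (k : ℕ))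
    (MeasurableSet.singleton (w.get k))

theorem isPiSystem_range_wordSet : IsPiSystem (Set.range wordSet) := by
  have key : ∀ w w' : List ℤ, w'.length ≤ w.length → (wordSet w ∩ wordSet w').Nonempty →
      wordSet w ∩ wordSet w' = wordSet w := by
    rintro w w' h ⟨x, hx, hx'⟩
    refine Set.inter_eq_left.2 fun y hy => mem_wordSet.2 fun k hk => ?_
    rw [mem_wordSet.1 hy k (hk.trans_le h), ← mem_wordSet.1 hx' k hk,
      mem_wordSet.1 hx k (hk.trans_le h)]
  rintro _ ⟨w, rfl⟩ _ ⟨w', rfl⟩ hne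
  rcases le_total w'.length w.length with h | h
  · exact ⟨w, (key w w' h hne).symm⟩
  · rw [Set.inter_comm] at hne ⊢
    exact ⟨w', (key w' w h hne).symm⟩

theorem generateFrom_range_wordSet :
    (MeasurableSpace.pi : MeasurableSpace (ℕ → ℤ)) =
      MeasurableSpace.generateFrom (Set.range wordSet) := by
  refine le_antisymm (iSup_le fun k => ?_) (MeasurableSpace.generateFrom_le ?_)
  · rintro _ ⟨s, -, rfl⟩
    -- There are only countably many words, so a condition on one digit is a countable union of
    -- cylinders.
    have h : (fun x : ℕ → ℤ => x k) ⁻¹' s =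
        ⋃ w ∈ {w : List ℤ | ∃ h : k < w.length, w[k] ∈ s}, wordSet w := by
      ext x
      simp only [Set.mem_preimage, Set.mem_iUnion, Set.mem_ofPred_eq, mem_wordSet]
      constructor
      · intro hx
        refine ⟨List.ofFn fun j : Fin (k + 1) => x j, ⟨by simp, by rwa [List.getElem_ofFn]⟩,
          fun j hj => by rw [List.getElem_ofFn]⟩
      · rintro ⟨w, ⟨h, hw⟩, hx⟩
        rwa [hx k h]
    rw [h]
    exact MeasurableSet.biUnion (Set.to_countable _) fun w _ =>
      MeasurableSpace.measurableSet_generateFrom ⟨w, rfl⟩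
  · rintro _ ⟨w, rfl⟩
    exact measurableSet_wordSet w

/-- A finite measure on integer sequences is determined by its values on cylinders. -/
theorem ext_of_wordSet {μ ν : Measure (ℕ → ℤ)} [IsFiniteMeasure μ]
    (h : ∀ w, μ (wordSet w) = ν (wordSet w)) : μ = ν := by
  refine ext_of_generate_finite _ generateFrom_range_wordSet isPiSystem_range_wordSet ?_ ?_
  · rintro _ ⟨w, rfl⟩
    exact h w
  · simpa using h []

namespace DigitAutomaton

theorem ext_of_cylinder {K : Set (ℕ → ℤ)} {μ ν : Measure K} [IsFiniteMeasure μ]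
    (h : ∀ w, μ (cylinder K w) = ν (cylinder K w)) : μ = ν := by
  have hmap : μ.map Subtype.val = ν.map Subtype.val := by
    refine ext_of_wordSet fun w => ?_
    rw [Measure.map_apply measurable_subtype_coe (measurableSet_wordSet w),
      Measure.map_apply measurable_subtype_coe (measurableSet_wordSet w)]
    exact h w
  ext s hs
  obtain ⟨t, ht, rfl⟩ := hs
  rw [← Measure.map_apply measurable_subtype_coe ht, hmap,
    Measure.map_apply measurable_subtype_coe ht]

theorem isFiniteMeasure_of_cylinder {K : Set (ℕ → ℤ)} {μ : Measure K} {c : ℝ}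
    (h : μ (cylinder K []) = ENNReal.ofReal c) : IsFiniteMeasure μ := by
  have huniv : cylinder K [] = Set.univ :=
    Set.eq_univ_of_forall fun _ k => absurd k.2 (Nat.not_lt_zero _)
  exact ⟨by rw [← huniv, h]; exact ENNReal.ofReal_lt_top⟩

/-! ### Markov chains on the edges -/

variable {V : Type*} (A : DigitAutomaton V) [DecidableEq V]

/-- The function `p` assigns positive transition probabilities to the edges. -/
structure IsTransition (p : V × ℤ × V → ℝ) : Prop where
  pos : ∀ e ∈ A.edges, 0 < p e
  sum_eq_one : ∀ i, ∑ e ∈ A.outEdges i, p e = 1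

/-- The probability that a path from a given vertex has a label beginning with a given word. -/
noncomputable def wordProb (p : V × ℤ × V → ℝ) : List ℤ → V → ℝ
  | [], _ => 1
  | a :: w, i => ∑ e ∈ A.outEdges i with lab e = a, p e * wordProb p w (tgt e)

/-- The type of edges that start in a given vertex. -/
def OutEdge (i : V) : Type _ := {e // e ∈ A.outEdges i}

instance (i : V) : Fintype (A.OutEdge i) := inferInstanceAs (Fintype {e // e ∈ A.outEdges i})

instance (i : V) : MeasurableSpace (A.OutEdge i) := ⊤

instance (i : V) : DiscreteMeasurableSpace (A.OutEdge i) := ⟨fun _ => trivial⟩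

/-- The law of the next edge. -/
noncomputable def outMeasure (p : V × ℤ × V → ℝ) (i : V) : Measure (A.OutEdge i) :=
  ∑ e : A.OutEdge i, ENNReal.ofReal (p e.1) • Measure.dirac e

theorem outMeasure_singleton (p : V × ℤ × V → ℝ) {i : V} (e : A.OutEdge i) :
    A.outMeasure p i {e} = ENNReal.ofReal (p e.1) := by
  classical
  simp only [outMeasure, Measure.finsetSum_apply, Measure.smul_apply, smul_eq_mul]
  rw [Finset.sum_eq_single e]
  · simp
  · intro f _ hf
    simp [hf]
  · simp

variable {A} in
theorem IsTransition.isProbabilityMeasure {p : V × ℤ × V → ℝ} (hp : A.IsTransition p) (i : V) :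
    IsProbabilityMeasure (A.outMeasure p i) := by
  refine ⟨?_⟩
  simp only [outMeasure, Measure.finsetSum_apply, Measure.smul_apply, smul_eq_mul,
    measure_univ, mul_one]
  rw [← ENNReal.ofReal_sum_of_nonneg fun e _ => (hp.pos _ (A.mem_outEdges.1 e.2).1).le]
  have : ∑ e : A.OutEdge i, p e.1 = ∑ e ∈ A.outEdges i, p e := Finset.sum_coe_sort _ _
  rw [this, hp.sum_eq_one, ENNReal.ofReal_one]

/-- The path that starts at time `k` in the vertex `i` and follows at each time `n` and in each
vertex `j` the edge `ω (n, j)`. -/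
def follow (ω : (q : ℕ × V) → A.OutEdge q.2) : ℕ → V → ℕ → V × ℤ × V
  | k, i, 0 => (ω (k, i)).1
  | k, i, n + 1 => follow ω (k + 1) (tgt (ω (k, i)).1) n

variable {A} in
theorem src_follow_zero (ω : (q : ℕ × V) → A.OutEdge q.2) (k : ℕ) (i : V) :
    src (A.follow ω k i 0) = i :=
  (A.mem_outEdges.1 (ω (k, i)).2).2

variable {A} in
theorem isInfinitePath_follow (ω : (q : ℕ × V) → A.OutEdge q.2) (k : ℕ) (i : V) :
    A.IsInfinitePath (A.follow ω k i) := by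
  intro n
  induction n generalizing k i with
  | zero => exact ⟨(A.mem_outEdges.1 (ω (k, i)).2).1, (src_follow_zero ω _ _).symm⟩
  | succ n ih => exact ih _ _

/-- Which coordinate is read later depends on `ω` itself. Freezing the first edge, which has
finitely many values, removes this dependence one step at a time. -/
theorem measurable_lab_follow (k : ℕ) (i : V) (n : ℕ) :
    Measurable fun ω : (q : ℕ × V) → A.OutEdge q.2 => lab (A.follow ω k i n) := by
  induction n generalizing k i with
  | zero =>
    exact (Measurable.of_discrete (f := fun e : A.OutEdge i => lab e.1)).comp
      (measurable_pi_apply (k, i))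
  | succ n ih =>
    have h : Measurable fun q : A.OutEdge i × ((q : ℕ × V) → A.OutEdge q.2) =>
        lab (A.follow q.2 (k + 1) (tgt q.1.1) n) :=
      measurable_from_prod_countable_right fun e => ih (k + 1) (tgt e.1)
    have h' : Measurable fun ω : (q : ℕ × V) → A.OutEdge q.2 => (ω (k, i), ω) :=
      (measurable_pi_apply (k, i)).prodMk measurable_id
    exact h.comp h'

theorem wordProb_nonneg {p : V × ℤ × V → ℝ} (hp : A.IsTransition p) (w : List ℤ) (i : V) :
    0 ≤ A.wordProb p w i := by
  induction w generalizing i with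
  | nil => exact zero_le_one
  | cons a w ih =>
    refine Finset.sum_nonneg fun e he => mul_nonneg (hp.pos e ?_).le (ih _)
    exact (A.mem_outEdges.1 (Finset.mem_filter.1 he).1).1

/-- The law of a path from time `k` on is independent of what happened before. -/
theorem infinitePi_inter_follow {p : V × ℤ × V → ℝ} (hp : A.IsTransition p)
    [∀ i, IsProbabilityMeasure (A.outMeasure p i)] (w : List ℤ) (k : ℕ) (i : V)
    (s : Finset (ℕ × V)) (t : (q : ℕ × V) → Set (A.OutEdge q.2)) (hs : ∀ q ∈ s, q.1 < k) :
    Measure.infinitePi (fun q : ℕ × V => A.outMeasure p q.2)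
        (Set.pi s t ∩ {ω | (fun n => lab (A.follow ω k i n)) ∈ wordSet w}) =
      Measure.infinitePi (fun q : ℕ × V => A.outMeasure p q.2) (Set.pi s t) *
        ENNReal.ofReal (A.wordProb p w i) := by
  classical
  induction w generalizing k i s t with
  | nil => simp [wordProb]
  | cons a w ih =>
    -- The box `Set.pi s t` records the past. All its coordinates have time below `k`, so the choice
    -- made at `(k, i)` is independent of it; fixing that choice gives a larger box and the shorter
    -- word `w` from time `k + 1`.
    have hks : (k, i) ∉ s := fun h => (hs _ h).ne rfl
    let t' : A.OutEdge i → (q : ℕ × V) → Set (A.OutEdge q.2) := fun e =>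
      Function.update t (k, i) {e}
    have hpi : ∀ e ω, ω ∈ Set.pi (↑(insert (k, i) s)) (t' e) ↔ ω (k, i) = e ∧ ω ∈ Set.pi s t := by
      intro e ω
      have h1 : ∀ q ∈ s, t' e q = t q := fun q hq =>
        Function.update_of_ne (fun h : q = (k, i) => hks (h ▸ hq)) _ _
      simp only [Set.mem_pi, Finset.mem_coe, Finset.mem_insert, forall_eq_or_imp]
      refine and_congr (by simp [t']) (forall₂_congr fun q hq => by rw [h1 q hq])
    have hset : Set.pi s t ∩ {ω | (fun n => lab (A.follow ω k i n)) ∈ wordSet (a :: w)} =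
        ⋃ e ∈ (Finset.univ : Finset (A.OutEdge i)).filter (fun e => lab e.1 = a),
          (Set.pi (↑(insert (k, i) s)) (t' e) ∩
            {ω | (fun n => lab (A.follow ω (k + 1) (tgt e.1) n)) ∈ wordSet w}) := by
      ext ω
      simp only [Set.mem_inter_iff, Set.mem_ofPred_eq, mem_wordSet_cons, Set.mem_iUnion, hpi,
        Finset.mem_filter, Finset.mem_univ, true_and]
      constructor
      · rintro ⟨h1, h2, h3⟩
        exact ⟨_, h2, ⟨rfl, h1⟩, h3⟩
      · rintro ⟨_, h2, ⟨rfl, h1⟩, h3⟩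
        exact ⟨h1, h2, h3⟩
    have hmeas : ∀ e : A.OutEdge i, MeasurableSet (Set.pi (↑(insert (k, i) s)) (t' e) ∩
        {ω | (fun n => lab (A.follow ω (k + 1) (tgt e.1) n)) ∈ wordSet w}) := fun e =>
      (MeasurableSet.pi (Finset.countable_toSet _) fun _ _ => .of_discrete).inter
        (measurable_pi_iff.2 (fun n => A.measurable_lab_follow _ _ n) (measurableSet_wordSet w))
    have hbox : ∀ e : A.OutEdge i,
        Measure.infinitePi (fun q : ℕ × V => A.outMeasure p q.2)
          (Set.pi (↑(insert (k, i) s)) (t' e)) = ENNReal.ofReal (p e.1) *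
        Measure.infinitePi (fun q : ℕ × V => A.outMeasure p q.2) (Set.pi s t) := by
      intro e
      rw [Measure.infinitePi_pi _ (fun _ _ => .of_discrete),
        Measure.infinitePi_pi _ (fun _ _ => .of_discrete), Finset.prod_insert hks]
      congr 1
      · simp only [t', Function.update_self]
        exact A.outMeasure_singleton p e
      · refine Finset.prod_congr rfl fun q hq => ?_
        simp only [t']
        rw [Function.update_of_ne (fun h : q = (k, i) => hks (h ▸ hq))]
    rw [hset, measure_biUnion_finset _ fun e _ => hmeas e]
    · have hs' : ∀ q ∈ insert (k, i) s, q.1 < k + 1 := by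
        intro q hq
        rcases Finset.mem_insert.1 hq with rfl | hq
        · exact Nat.lt_succ_self _
        · exact (hs q hq).trans (Nat.lt_succ_self _)
      simp only [ih _ _ _ _ hs', hbox]
      have hsum : A.wordProb p (a :: w) i = ∑ e : A.OutEdge i with lab e.1 = a,
          p e.1 * A.wordProb p w (tgt e.1) := by
        rw [wordProb, Finset.sum_filter, Finset.sum_filter]
        exact (Finset.sum_coe_sort (A.outEdges i)
          fun e => if lab e = a then p e * A.wordProb p w (tgt e) else 0).symm
      have hpos : ∀ e : A.OutEdge i, 0 ≤ p e.1 := fun e =>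
        (hp.pos _ (A.mem_outEdges.1 e.2).1).le
      rw [hsum, ENNReal.ofReal_sum_of_nonneg fun e _ =>
        mul_nonneg (hpos e) (A.wordProb_nonneg hp _ _), Finset.mul_sum]
      refine Finset.sum_congr rfl fun e _ => ?_
      rw [ENNReal.ofReal_mul (hpos e)]
      ring
    · intro e _ f _ hef
      refine Set.disjoint_left.2 fun ω h1 h2 => hef ?_
      exact ((hpi e ω).1 h1.1).1.symm.trans ((hpi f ω).1 h2.1).1

/-- A family of random label sequences of infinite paths, one for each initial vertex. -/
theorem exists_labelProcess {V : Type*} [DecidableEq V] (A : DigitAutomaton V)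
    {p : V × ℤ × V → ℝ} (hp : A.IsTransition p) :
    ∃ (P : Measure ((q : ℕ × V) → A.OutEdge q.2))
      (X : V → ((q : ℕ × V) → A.OutEdge q.2) → ℕ → ℤ),
      IsProbabilityMeasure P ∧ (∀ i, Measurable (X i)) ∧
      (∀ i ω, ∃ e, A.IsInfinitePath e ∧ src (e 0) = i ∧ ∀ k, X i ω k = lab (e k)) ∧
      ∀ i w, P (X i ⁻¹' wordSet w) = ENNReal.ofReal (A.wordProb p w i) := by
  have := hp.isProbabilityMeasure
  refine ⟨Measure.infinitePi (fun q : ℕ × V => A.outMeasure p q.2),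
    fun i ω n => lab (A.follow ω 0 i n), inferInstance,
    fun i => measurable_pi_iff.2 (A.measurable_lab_follow 0 i),
    fun i ω => ⟨_, isInfinitePath_follow ω 0 i, src_follow_zero ω 0 i, fun _ => rfl⟩, fun i w => ?_⟩
  have h := A.infinitePi_inter_follow hp w 0 i ∅ (fun _ => Set.univ) (by simp)
  simp only [Finset.coe_empty, Set.empty_pi, Set.univ_inter, measure_univ, one_mul] at h
  exact h

end DigitAutomaton

/-! ### Harmonic functions and convergence of digit series -/

namespace DigitAutomaton

variable {V : Type*} [DecidableEq V] {A : DigitAutomaton V}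

/-- A function that is harmonic for a Markov chain on a primitive automaton is constant. -/
theorem IsTransition.eq_of_harmonic [Fintype V] {p : V × ℤ × V → ℝ} (hp : A.IsTransition p)
    (hM : A.transitionMatrix.IsPrimitive) {h : V → ℝ}
    (hh : ∀ i, h i = ∑ e ∈ A.outEdges i, p e * h (tgt e)) (i j : V) : h i = h j := by
  -- Maximum principle: the set where `h` is maximal is closed under following edges.
  obtain ⟨m, -, hm⟩ := Finset.exists_max_image Finset.univ h ⟨i, Finset.mem_univ _⟩
  have key : ∀ k, k ∈ {k | h k = h m} := by
    refine A.mem_of_closed hM ⟨m, rfl⟩ fun e he hs => ?_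
    simp only [Set.mem_ofPred_eq] at hs ⊢
    have h0 : ∑ f ∈ A.outEdges (src e), p f * (h m - h (tgt f)) = 0 := by
      simp only [mul_sub, Finset.sum_sub_distrib, ← Finset.sum_mul, hp.sum_eq_one, ← hh, hs]
      ring
    have h1 := (Finset.sum_eq_zero_iff_of_nonneg fun f hf =>
      mul_nonneg (hp.pos f (A.mem_outEdges.1 hf).1).le
        (sub_nonneg.2 (hm (tgt f) (Finset.mem_univ _)))).1 h0 e (A.mem_outEdges.2 ⟨he, rfl⟩)
    rcases mul_eq_zero.1 h1 with h2 | h2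
    · exact absurd h2 (hp.pos e he).ne'
    · linarith
  exact (key i).trans (key j).symm

omit [DecidableEq V] in
theorem IsInfinitePath.summable {e : ℕ → V × ℤ × V} (he : A.IsInfinitePath e) {β : ℝ}
    (hβ : 1 < β) : Summable fun k : ℕ => (lab (e k) : ℝ) / β ^ (k + 1) := by
  have hβ0 : 0 < β := by linarith
  obtain ⟨B, hB⟩ := (A.edges.finite_toSet.image fun f => |(lab f : ℝ)|).bddAbove
  refine Summable.of_norm_bounded (g := fun k : ℕ => B * β⁻¹ ^ (k + 1)) ?_ fun k => ?_
  · exact (((summable_nat_add_iff 1).2 (summable_geometric_of_lt_one (inv_pos.2 hβ0).le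
      (inv_lt_one_of_one_lt₀ hβ))).mul_left B)
  · rw [norm_div, Real.norm_eq_abs, norm_pow, Real.norm_of_nonneg hβ0.le, div_eq_mul_inv, inv_pow]
    exact mul_le_mul_of_nonneg_right (hB ⟨e k, (he k).1, rfl⟩) (by positivity)

/-! ### Self-similar families of measures -/

variable (A) in
/-- The measures `ν i` are related to each other as the laws of `∑ x_k β^{-k}`, where `x` is the
label of a random path that starts in `i`. -/
def IsSelfSimilar (p : V × ℤ × V → ℝ) (β : ℝ) (ν : V → Measure ℝ) : Prop :=
  ∀ i, ν i = ∑ e ∈ A.outEdges i,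
    ENNReal.ofReal (p e) • (ν (tgt e)).map fun x => ((lab e : ℝ) + x) / β

variable {p : V × ℤ × V → ℝ} {β : ℝ} {ν η : V → Measure ℝ}

theorem measurable_digit_add (a : ℤ) (β : ℝ) : Measurable fun x : ℝ => ((a : ℝ) + x) / β := by
  fun_prop

namespace IsSelfSimilar

theorem real_apply [∀ i, IsFiniteMeasure (ν i)] (hν : A.IsSelfSimilar p β ν)
    (hp : A.IsTransition p) (i : V) {s : Set ℝ} (hs : MeasurableSet s) :
    (ν i).real s = ∑ e ∈ A.outEdges i,
      p e * (ν (tgt e)).real ((fun x => ((lab e : ℝ) + x) / β) ⁻¹' s) := by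
  rw [Measure.real, hν i, Measure.finsetSum_apply, ENNReal.toReal_sum]
  · refine Finset.sum_congr rfl fun e he => ?_
    rw [Measure.smul_apply, Measure.map_apply (measurable_digit_add _ _) hs, smul_eq_mul,
      ENNReal.toReal_mul, ENNReal.toReal_ofReal (hp.pos e (A.mem_outEdges.1 he).1).le]
    rfl
  · intro e _
    rw [Measure.smul_apply, Measure.map_apply (measurable_digit_add _ _) hs]
    exact ENNReal.mul_ne_top ENNReal.ofReal_ne_top (measure_ne_top _ _)

theorem charFun_eq [∀ i, IsFiniteMeasure (ν i)] (hν : A.IsSelfSimilar p β ν)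
    (hp : A.IsTransition p) (i : V) (t : ℝ) :
    charFun (ν i) t = ∑ e ∈ A.outEdges i, (p e : ℂ) *
      (Complex.exp ((t / β * lab e : ℝ) * Complex.I) * charFun (ν (tgt e)) (t / β)) := by
  have hbd : ∀ (μ : Measure ℝ) [IsFiniteMeasure μ],
      Integrable (fun x : ℝ => Complex.exp (t * x * Complex.I)) μ := fun μ _ => by
    refine Integrable.of_bound (by fun_prop) 1 (ae_of_all _ fun x => ?_)
    rw [← Complex.ofReal_mul, Complex.norm_exp_ofReal_mul_I]
  rw [charFun_apply_real]
  conv_lhs => rw [hν i]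
  rw [integral_finsetSum_measure fun e _ => (hbd _).smul_measure ENNReal.ofReal_ne_top]
  refine Finset.sum_congr rfl fun e he => ?_
  rw [integral_smul_measure, ENNReal.toReal_ofReal (hp.pos e (A.mem_outEdges.1 he).1).le,
    integral_map (measurable_digit_add _ _).aemeasurable (by fun_prop), charFun_apply_real,
    Complex.real_smul, ← integral_const_mul (Complex.exp _)]
  refine congrArg ((p e : ℂ) * ·) (integral_congr_ae (ae_of_all _ fun x => ?_))
  dsimp only
  rw [← Complex.exp_add]
  congr 1
  push_cast
  ring

/-- Self-similar families of finite measures are determined by their masses. -/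
theorem ext [Fintype V] [∀ i, IsFiniteMeasure (ν i)] [∀ i, IsFiniteMeasure (η i)]
    (hν : A.IsSelfSimilar p β ν) (hη : A.IsSelfSimilar p β η) (hp : A.IsTransition p)
    (hβ : 1 < β) (h : ∀ i, ν i Set.univ = η i Set.univ) (i : V) : ν i = η i := by
  have hstep : ∀ i t, ‖charFun (ν i) t - charFun (η i) t‖ ≤ ∑ e ∈ A.outEdges i,
      p e * ‖charFun (ν (tgt e)) (t / β) - charFun (η (tgt e)) (t / β)‖ := fun i t => by
    rw [hν.charFun_eq hp, hη.charFun_eq hp, ← Finset.sum_sub_distrib]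
    refine (norm_sum_le _ _).trans (Finset.sum_le_sum fun e he => le_of_eq ?_)
    rw [← mul_sub, ← mul_sub, norm_mul, norm_mul, Complex.norm_exp_ofReal_mul_I, one_mul,
      Complex.norm_of_nonneg (hp.pos e (A.mem_outEdges.1 he).1).le]
  refine Measure.ext_of_charFun (funext fun t => ?_)
  rw [← sub_eq_zero, ← norm_le_zero_iff]
  refine le_of_forall_pos_le_add fun ε hε => ?_
  rw [zero_add]
  -- At 0 a characteristic function is the total mass, so the difference is small near 0. By `hstep`
  -- the bound at `t / β` passes to `t`, hence to ever larger balls.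
  have hnear : ∀ᶠ t in 𝓝 (0 : ℝ), ∀ i, ‖charFun (ν i) t - charFun (η i) t‖ < ε := by
    refine eventually_all.2 fun i => ?_
    have hc : Continuous fun t => ‖charFun (ν i) t - charFun (η i) t‖ :=
      (continuous_charFun.sub continuous_charFun).norm
    refine hc.tendsto 0 (Iio_mem_nhds ?_)
    simp [Measure.real, h i, hε]
  obtain ⟨δ, hδ, hball⟩ := Metric.eventually_nhds_iff.1 hnear
  have key : ∀ (n : ℕ) t, |t| < δ * β ^ n → ∀ i, ‖charFun (ν i) t - charFun (η i) t‖ ≤ ε := by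
    intro n
    induction n with
    | zero => exact fun t ht i => (hball (by simpa using ht) i).le
    | succ n ih =>
      intro t ht i
      have hβ0 : 0 < β := by linarith
      have ht' : |t / β| < δ * β ^ n := by
        rw [abs_div, abs_of_pos hβ0, div_lt_iff₀ hβ0, mul_assoc, ← pow_succ]
        exact ht
      calc _ ≤ _ := hstep i t
        _ ≤ ∑ e ∈ A.outEdges i, p e * ε := Finset.sum_le_sum fun e he =>
          mul_le_mul_of_nonneg_left (ih _ ht' _) (hp.pos e (A.mem_outEdges.1 he).1).le
        _ = ε := by rw [← Finset.sum_mul, hp.sum_eq_one, one_mul]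
  obtain ⟨n, hn⟩ := pow_unbounded_of_one_lt (|t| / δ) hβ
  exact key n t (by rwa [div_lt_iff₀' hδ] at hn) i

/-- A zero-one law for sets that are invariant under all maps `x ↦ (a + x) / β`. -/
theorem zero_or_one [Fintype V] [∀ i, IsProbabilityMeasure (ν i)] (hν : A.IsSelfSimilar p β ν)
    (hp : A.IsTransition p) (hM : A.transitionMatrix.IsPrimitive) (hβ : 1 < β) {N : Set ℝ}
    (hN : MeasurableSet N) (hinv : ∀ (a : ℤ) x, ((a : ℝ) + x) / β ∈ N ↔ x ∈ N) :
    (∀ i, ν i N = 0) ∨ ∀ i, ν i Nᶜ = 0 := by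
  rcases isEmpty_or_nonempty V with hV | ⟨⟨i₀⟩⟩
  · exact Or.inl fun i => hV.elim i
  have hpre : ∀ a : ℤ, (fun x : ℝ => ((a : ℝ) + x) / β) ⁻¹' N = N := fun a => Set.ext (hinv a)
  have hconst : ∀ i, ν i N = ν i₀ N := fun i => by
    have h := hp.eq_of_harmonic hM (h := fun i => (ν i).real N) (fun i => by
      simpa only [hpre] using hν.real_apply hp i hN) i i₀
    exact (ENNReal.toReal_eq_toReal_iff' (measure_ne_top _ _) (measure_ne_top _ _)).1 h
  set c := ν i₀ N with hc
  have hcfin : c ≠ ⊤ := measure_ne_top _ _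
  -- Invariance of `N` lets restriction commute with the digit maps.
  have h1 : A.IsSelfSimilar p β fun i => (ν i).restrict N := fun i => by
    have h : (ν i).restrict N = Measure.restrictₗ N (ν i) := rfl
    simp only [h]
    conv_lhs => rw [hν i, map_sum]
    refine Finset.sum_congr rfl fun e _ => ?_
    rw [map_smul, Measure.restrictₗ_apply, Measure.restrict_map (measurable_digit_add _ _) hN,
      hpre]
  have h2 : A.IsSelfSimilar p β fun i => c • ν i := fun i => by
    dsimp only
    conv_lhs => rw [hν i, Finset.smul_sum]
    refine Finset.sum_congr rfl fun e _ => ?_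
    rw [Measure.map_smul, smul_comm]
  have hfin : ∀ i, IsFiniteMeasure (c • ν i) := fun i => Measure.smul_finite _ hcfin
  have h3 := fun i => h1.ext h2 hp hβ (fun i => by simp [hconst]) i
  have h4 : c = c * c := by
    have h5 := congrArg (fun μ : Measure ℝ => μ N) (h3 i₀)
    simpa [← hc] using h5
  rcases eq_or_ne c 0 with h0 | h0
  · exact Or.inl fun i => (hconst i).trans h0
  · refine Or.inr fun i => (prob_compl_eq_zero_iff hN).2 ?_
    rw [hconst i]
    exact ((ENNReal.mul_eq_left h0 hcfin).1 h4.symm)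

end IsSelfSimilar

/-! ### Invariant null sets and the Lebesgue type -/

/-- The union of all images of a set under affine maps with algebraic coefficients. -/
def affineSaturation (N : Set ℝ) : Set ℝ :=
  ⋃ a ∈ {a : ℝ | IsAlgebraic ℚ a ∧ a ≠ 0}, ⋃ b ∈ {b : ℝ | IsAlgebraic ℚ b},
    (fun x => a * x) ⁻¹' ((fun x => x + b) ⁻¹' N)

theorem mem_affineSaturation {N : Set ℝ} {x : ℝ} : x ∈ affineSaturation N ↔
    ∃ a b, IsAlgebraic ℚ a ∧ a ≠ 0 ∧ IsAlgebraic ℚ b ∧ a * x + b ∈ N := by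
  simp only [affineSaturation, Set.mem_iUnion, Set.mem_ofPred_eq, Set.mem_preimage, exists_prop]
  constructor
  · rintro ⟨a, ⟨h1, h2⟩, b, h3, h4⟩
    exact ⟨a, b, h1, h2, h3, h4⟩
  · rintro ⟨a, b, h1, h2, h3, h4⟩
    exact ⟨a, ⟨h1, h2⟩, b, h3, h4⟩

theorem countable_isAlgebraic : {b : ℝ | IsAlgebraic ℚ b}.Countable := Algebraic.countable ℚ ℝ

theorem countable_isAlgebraic_ne_zero : {b : ℝ | IsAlgebraic ℚ b ∧ b ≠ 0}.Countable :=
  countable_isAlgebraic.mono fun _ h => h.1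

theorem measurableSet_affineSaturation {N : Set ℝ} (hN : MeasurableSet N) :
    MeasurableSet (affineSaturation N) :=
  MeasurableSet.biUnion countable_isAlgebraic_ne_zero fun a _ =>
    MeasurableSet.biUnion countable_isAlgebraic fun b _ =>
      (measurable_const_mul a) ((measurable_add_const b) hN)

theorem volume_affineSaturation {N : Set ℝ} (hN : volume N = 0) :
    volume (affineSaturation N) = 0 := by
  refine (measure_biUnion_null_iff countable_isAlgebraic_ne_zero).2 fun a ha =>
    (measure_biUnion_null_iff countable_isAlgebraic).2 fun b _ => ?_
  rw [Real.volume_preimage_mul_left ha.2, measure_preimage_add_right, hN, mul_zero]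

theorem subset_affineSaturation (N : Set ℝ) : N ⊆ affineSaturation N := fun x hx =>
  mem_affineSaturation.2 ⟨1, 0, isAlgebraic_one, one_ne_zero, isAlgebraic_zero, by simpa⟩

/-- The affine maps with algebraic coefficients form a group containing the digit maps. -/
theorem digit_add_mem_affineSaturation (hβ : IsAlgebraic ℚ β) (hβ0 : β ≠ 0) (N : Set ℝ) (d : ℤ)
    (x : ℝ) : ((d : ℝ) + x) / β ∈ affineSaturation N ↔ x ∈ affineSaturation N := by
  have hd : IsAlgebraic ℚ (d : ℝ) := isAlgebraic_intCast d
  simp only [mem_affineSaturation]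
  constructor
  · rintro ⟨a, b, h1, h2, h3, h4⟩
    refine ⟨a * β⁻¹, a * β⁻¹ * d + b, h1.mul hβ.inv, mul_ne_zero h2 (inv_ne_zero hβ0),
      ((h1.mul hβ.inv).mul hd).add h3, ?_⟩
    convert h4 using 1
    field_simp
    ring
  · rintro ⟨a, b, h1, h2, h3, h4⟩
    refine ⟨a * β, b - a * d, h1.mul hβ, mul_ne_zero h2 hβ0, h3.sub (h1.mul hd), ?_⟩
    convert h4 using 1
    field_simp
    ring

namespace IsSelfSimilar

variable [Fintype V] [∀ i, IsProbabilityMeasure (ν i)]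

/-- The measures of a self-similar family are all absolutely continuous, or all carried by one
set of Lebesgue measure zero. -/
theorem absolutelyContinuous_or_singular (hν : A.IsSelfSimilar p β ν)
    (hp : A.IsTransition p) (hM : A.transitionMatrix.IsPrimitive) (hβ : 1 < β)
    (hβa : IsAlgebraic ℚ β) :
    (∀ i, (ν i).AbsolutelyContinuous volume) ∨
      ∃ N, MeasurableSet N ∧ volume N = 0 ∧ ∀ i, ν i Nᶜ = 0 := by
  by_cases hac : ∀ i, (ν i).AbsolutelyContinuous volume
  · exact Or.inl hac
  refine Or.inr ?_
  obtain ⟨i, hi⟩ := not_forall.1 hac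
  obtain ⟨s, hs, hvs, hνs⟩ : ∃ s, MeasurableSet s ∧ volume s = 0 ∧ ν i s ≠ 0 := by
    by_contra! hcon
    exact hi (Measure.AbsolutelyContinuous.mk fun s hs h => hcon s hs h)
  have hN := measurableSet_affineSaturation hs
  refine ⟨affineSaturation s, hN, volume_affineSaturation hvs, ?_⟩
  refine (hν.zero_or_one hp hM hβ hN
    (digit_add_mem_affineSaturation hβa (by linarith) s)).resolve_left fun h => ?_
  exact hνs (measure_mono_null (subset_affineSaturation s) (h i))

/-- If a measure of a self-similar family has an atom, then the value of an infinite path depends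
only on its initial vertex. -/
theorem exists_value_of_atom (hν : A.IsSelfSimilar p β ν)
    (hp : A.IsTransition p) (hM : A.transitionMatrix.IsPrimitive) (hβ : 1 < β)
    {i₀ : V} {x₀ : ℝ} (h₀ : ν i₀ {x₀} ≠ 0) :
    ∃ y : V → ℝ, ∀ e, A.IsInfinitePath e →
      HasSum (fun k : ℕ => (lab (e k) : ℝ) / β ^ (k + 1)) (y (src (e 0))) := by
  have hβ0 : 0 < β := by linarith
  -- A finite measure has finitely many atoms above a given positive mass, so the largest atomic
  -- mass over all vertices is attained.
  have hfin : {q : V × ℝ | ν i₀ {x₀} ≤ ν q.1 {q.2}}.Finite := by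
    have h1 : ∀ i, {x : ℝ | ν i₀ {x₀} ≤ ν i {x}}.Finite := fun i =>
      Measure.finite_const_le_meas_of_disjoint_iUnion (ν i) (pos_iff_ne_zero.2 h₀)
        (fun x => measurableSet_singleton x)
        (fun x y hxy => Set.disjoint_singleton.2 hxy) (measure_ne_top _ _)
    refine (Set.finite_iUnion fun i => (h1 i).image (Prod.mk i)).subset ?_
    rintro ⟨i, x⟩ h
    exact Set.mem_iUnion.2 ⟨i, x, h, rfl⟩
  obtain ⟨⟨i₁, x₁⟩, hm₁, hmax⟩ := Set.exists_max_image _ (fun q : V × ℝ => ν q.1 {q.2}) hfin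
    ⟨(i₀, x₀), le_refl (ν i₀ {x₀})⟩
  have hle : ∀ i x, (ν i).real {x} ≤ (ν i₁).real {x₁} := fun i x => by
    refine ENNReal.toReal_mono (measure_ne_top _ _) ?_
    by_cases h : ν i₀ {x₀} ≤ ν i {x}
    · exact hmax (i, x) h
    · exact (not_le.1 h).le.trans hm₁
  set m := (ν i₁).real {x₁} with hm
  let F : Set (V × ℝ) := {q | (ν q.1).real {q.2} = m}
  have hFfin : F.Finite := by
    refine hfin.subset fun q (hq : (ν q.1).real {q.2} = m) => ?_
    have h := (ENNReal.toReal_eq_toReal_iff' (measure_ne_top _ _) (measure_ne_top _ _)).1 hq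
    exact hm₁.trans_eq h.symm
  have hpre : ∀ (a : ℤ) (x : ℝ), (fun y : ℝ => ((a : ℝ) + y) / β) ⁻¹' {x} = {β * x - a} := by
    intro a x
    ext y
    simp only [Set.mem_preimage, Set.mem_singleton_iff]
    rw [div_eq_iff hβ0.ne']
    constructor <;> intro h <;> linarith
  -- The mass at `x` is an average of masses at the preimages of `x`. As none exceeds `m`, all of
  -- them equal `m`.
  have hstep : ∀ e ∈ A.edges, ∀ x, (src e, x) ∈ F → (tgt e, β * x - lab e) ∈ F := by
    intro e he x hx
    have hx' : (ν (src e)).real {x} = m := hx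
    have h0 : ∑ f ∈ A.outEdges (src e), p f * (m - (ν (tgt f)).real {β * x - lab f}) = 0 := by
      have h := hν.real_apply hp (src e) (measurableSet_singleton x)
      simp only [hpre, hx'] at h
      simp only [mul_sub, Finset.sum_sub_distrib, ← Finset.sum_mul, hp.sum_eq_one] at h ⊢
      linarith
    have h1 := (Finset.sum_eq_zero_iff_of_nonneg fun f hf =>
      mul_nonneg (hp.pos f (A.mem_outEdges.1 hf).1).le
        (sub_nonneg.2 (hle _ _))).1 h0 e (A.mem_outEdges.2 ⟨he, rfl⟩)
    rcases mul_eq_zero.1 h1 with h2 | h2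
    · exact absurd h2 (hp.pos e he).ne'
    · exact (sub_eq_zero.1 h2).symm
  have hall : ∀ j, j ∈ {j | ∃ x, (j, x) ∈ F} :=
    A.mem_of_closed hM ⟨i₁, x₁, rfl⟩ fun e he ⟨x, hx⟩ => ⟨_, hstep e he x hx⟩
  choose y hy using hall
  obtain ⟨C, hC⟩ : ∃ C, ∀ q ∈ F, |q.2| ≤ C := by
    obtain ⟨C, hC⟩ := (hFfin.image fun q => |q.2|).bddAbove
    exact ⟨C, fun q hq => hC ⟨q, hq, rfl⟩⟩
  refine ⟨y, fun e he => ?_⟩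
  set z := y (src (e 0)) with hz
  -- The rescaled remainder after `n` digits stays in the finite set `F`; hence the remainder itself
  -- is at most `C * β⁻¹ ^ n`.
  have horbit : ∀ n, (src (e n), β ^ n * (z - ∑ k ∈ Finset.range n,
      (lab (e k) : ℝ) / β ^ (k + 1))) ∈ F := by
    intro n
    induction n with
    | zero => simpa using hy (src (e 0))
    | succ n ih =>
      have h := hstep (e n) (he n).1 _ ih
      rw [(he n).2] at h
      convert h using 2
      rw [Finset.sum_range_succ]
      field_simp
      ring
  have hlim : Tendsto (fun n => ∑ k ∈ Finset.range n, (lab (e k) : ℝ) / β ^ (k + 1)) atTop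
      (𝓝 z) := by
    rw [tendsto_iff_norm_sub_tendsto_zero]
    have hg : Tendsto (fun n : ℕ => C * β⁻¹ ^ n) atTop (𝓝 0) := by
      simpa using (tendsto_pow_atTop_nhds_zero_of_lt_one (inv_pos.2 hβ0).le
        (inv_lt_one_of_one_lt₀ hβ)).const_mul C
    refine squeeze_zero (fun _ => norm_nonneg _) (fun n => ?_) hg
    have h := hC _ (horbit n)
    simp only [abs_mul, abs_of_pos (pow_pos hβ0 n)] at h
    rw [norm_sub_rev, Real.norm_eq_abs, inv_pow, ← div_eq_mul_inv, le_div_iff₀' (pow_pos hβ0 n)]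
    exact h
  exact ((he.summable hβ).hasSum_iff_tendsto_nat).2 hlim

end IsSelfSimilar

end DigitAutomaton

/-! ### Digit sums of sequences -/

/-- The sequence `x` preceded by `a`. -/
def consSeq (a : ℤ) (x : ℕ → ℤ) : ℕ → ℤ
  | 0 => a
  | n + 1 => x n

theorem measurable_consSeq (a : ℤ) : Measurable (consSeq a) :=
  measurable_pi_iff.2 fun n => by
    cases n with
    | zero => exact measurable_const
    | succ n => exact measurable_pi_apply n

/-- The value `∑ x_k β^{-k}`, `k ≥ 1`, of a sequence. -/
noncomputable def digitSum (β : ℝ) (x : ℕ → ℤ) : ℝ := ∑' k : ℕ, (x k : ℝ) / β ^ (k + 1)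

theorem measurable_digitSum (β : ℝ) : Measurable (digitSum β) :=
  Measurable.tsum fun k => Measurable.div_const
    ((measurable_from_top (f := fun a : ℤ => (a : ℝ))).comp (measurable_pi_apply k)) _

theorem measurable_digitMap (β : ℝ) (K : Set (ℕ → ℤ)) : Measurable (digitMap β K) :=
  (measurable_digitSum β).comp measurable_subtype_coe

theorem digitSum_consSeq {β : ℝ} (a : ℤ) {x : ℕ → ℤ}
    (hx : Summable fun k : ℕ => (x k : ℝ) / β ^ (k + 1)) :
    digitSum β (consSeq a x) = ((a : ℝ) + digitSum β x) / β := by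
  have h : ∀ k : ℕ, (consSeq a x (k + 1) : ℝ) / β ^ (k + 1 + 1) = (x k : ℝ) / β ^ (k + 1) / β :=
    fun k => by rw [pow_succ β (k + 1), div_div, consSeq]
  have hs : Summable fun k : ℕ => (consSeq a x k : ℝ) / β ^ (k + 1) := by
    rw [← summable_nat_add_iff 1]
    simpa only [h] using hx.div_const β
  rw [digitSum, hs.tsum_eq_zero_add]
  simp only [h, tsum_div_const]
  rw [zero_add, pow_one, ← add_div, consSeq, digitSum]

namespace DigitAutomaton

variable {V : Type*} [Fintype V] [DecidableEq V] {A : DigitAutomaton V}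

/-! ### Perron–Frobenius data -/

theorem exists_isPerron [Nonempty V] (hM : A.transitionMatrix.IsPrimitive) :
    ∃ lam vL vR, A.IsPerron lam vL vR := by
  obtain ⟨r, hr, v, hv, hMv⟩ := hM.exists_pos_eigenvector
  obtain ⟨s, -, u, hu, hMu⟩ := hM.transpose.exists_pos_eigenvector
  rw [Matrix.mulVec_transpose] at hMu
  have huv : 0 < dotProduct u v :=
    Finset.sum_pos (fun i _ => mul_pos (hu i) (hv i)) Finset.univ_nonempty
  -- Evaluating `u ⬝ M v` in both ways identifies the left and right eigenvalues.
  have hsr : s = r := by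
    have h := Matrix.dotProduct_mulVec u A.transitionMatrix v
    rw [hMv, hMu, dotProduct_smul, smul_dotProduct] at h
    exact (mul_right_cancel₀ huv.ne' h).symm
  subst hsr
  refine ⟨s, (dotProduct u v)⁻¹ • u, v, hr, fun i => mul_pos (inv_pos.2 huv) (hu i), hv, ?_, hMv,
    ?_⟩
  · rw [Matrix.smul_vecMul, hMu, smul_comm]
  · rw [smul_dotProduct, smul_eq_mul, inv_mul_cancel₀ huv.ne']

omit [DecidableEq V] in
theorem IsPerron.eigenvalue_unique [Nonempty V] {lam lam' : ℝ} {vL vR vL' vR' : V → ℝ}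
    (h : A.IsPerron lam vL vR) (h' : A.IsPerron lam' vL' vR') : lam = lam' := by
  have hpos : 0 < dotProduct vL vR' :=
    Finset.sum_pos (fun i _ => mul_pos (h.left_pos i) (h'.right_pos i)) Finset.univ_nonempty
  have h1 := Matrix.dotProduct_mulVec vL A.transitionMatrix vR'
  rw [h'.right_eigen, h.left_eigen, dotProduct_smul, smul_dotProduct] at h1
  exact (mul_right_cancel₀ hpos.ne' h1).symm

/-- The eigenvectors can be rescaled reciprocally, but their products are entries of the limit of
the normalised powers of M. This makes the Parry measure independent of the choice of eigenvectors.
-/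
theorem IsPerron.projection_unique [Nonempty V] (hM : A.transitionMatrix.IsPrimitive)
    {lam lam' : ℝ} {vL vR vL' vR' : V → ℝ} (h : A.IsPerron lam vL vR)
    (h' : A.IsPerron lam' vL' vR') (i j : V) : vL i * vR j = vL' i * vR' j := by
  obtain rfl := h.eigenvalue_unique h'
  have h1 := hM.tendsto_pow_mulVec h.lam_pos h.left_pos h.right_pos h.left_eigen h.right_eigen
    h.normalised (Pi.single i 1) j
  have h2 := hM.tendsto_pow_mulVec h'.lam_pos h'.left_pos h'.right_pos h'.left_eigen
    h'.right_eigen h'.normalised (Pi.single i 1) j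
  simpa using tendsto_nhds_unique h1 h2

theorem IsPerron.dotProduct_unique [Nonempty V] (hM : A.transitionMatrix.IsPrimitive)
    {lam lam' : ℝ} {vL vR vL' vR' : V → ℝ} (h : A.IsPerron lam vL vR)
    (h' : A.IsPerron lam' vL' vR') (W : Matrix V V ℝ) :
    dotProduct vL (W.mulVec vR) = dotProduct vL' (W.mulVec vR') := by
  simp only [Matrix.mulVec, dotProduct, Finset.mul_sum]
  refine Finset.sum_congr rfl fun i _ => Finset.sum_congr rfl fun j _ => ?_
  rw [mul_left_comm, h.projection_unique hM h', mul_left_comm]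

/-- The transition probabilities of the Parry chain. -/
noncomputable def parryProb (lam : ℝ) (v : V → ℝ) (e : V × ℤ × V) : ℝ :=
  v (tgt e) / (lam * v (src e))

theorem IsPerron.isTransition {lam : ℝ} {vL vR : V → ℝ} (h : A.IsPerron lam vL vR) :
    A.IsTransition (parryProb lam vR) := by
  refine ⟨fun e _ => div_pos (h.right_pos _) (mul_pos h.lam_pos (h.right_pos _)), fun i => ?_⟩
  have h1 := A.transitionMatrix_mulVec vR i
  rw [h.right_eigen, Pi.smul_apply, smul_eq_mul] at h1
  have h2 : ∀ e ∈ A.outEdges i, parryProb lam vR e = vR (tgt e) / (lam * vR i) := fun e he => by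
    rw [parryProb, (A.mem_outEdges.1 he).2]
  rw [Finset.sum_congr rfl h2, ← Finset.sum_div, ← h1]
  exact div_self (mul_pos h.lam_pos (h.right_pos i)).ne'

/-- The ratios of values of `vR` telescope along each path, leaving one factor `lam⁻¹` per step and
the value at the end. -/
theorem IsPerron.mul_wordProb {lam : ℝ} {vL vR : V → ℝ} (h : A.IsPerron lam vL vR)
    (w : List ℤ) (i : V) : vR i * A.wordProb (parryProb lam vR) w i =
      (lam ^ w.length)⁻¹ * (A.wordMatrix w).mulVec vR i := by
  induction w generalizing i with
  | nil => simp [wordProb, wordMatrix]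
  | cons a w ih =>
    have hlam := h.lam_pos.ne'
    have hR := fun i => (h.right_pos i).ne'
    have h1 : A.wordMatrix (a :: w) = A.labelMatrix a * A.wordMatrix w := by simp [wordMatrix]
    rw [h1, ← Matrix.mulVec_mulVec, labelMatrix_mulVec, wordProb, Finset.mul_sum, Finset.mul_sum]
    refine Finset.sum_congr rfl fun e he => ?_
    have h2 := (A.mem_outEdges.1 (Finset.mem_filter.1 he).1).2
    have h3 : vR i * (parryProb lam vR e * A.wordProb (parryProb lam vR) w (tgt e)) =
        lam⁻¹ * (vR (tgt e) * A.wordProb (parryProb lam vR) w (tgt e)) := by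
      rw [parryProb, h2]
      field_simp [hR i]
    rw [h3, ih, List.length_cons, pow_succ, mul_inv]
    ring

/-! ### Mixtures of the laws of random paths -/

/-- The laws of the values of random paths with given initial vertices form a self-similar
family, and mixtures of the laws of their labels have the expected values on cylinders. -/
theorem IsTransition.exists_selfSimilar {V : Type*} [DecidableEq V] {A : DigitAutomaton V}
    {p : V × ℤ × V → ℝ} (hp : A.IsTransition p) {β : ℝ} (hβ : 1 < β) :
    ∃ ν : V → Measure ℝ, (∀ i, IsProbabilityMeasure (ν i)) ∧ A.IsSelfSimilar p β ν ∧
      ∀ (K : Set (ℕ → ℤ)) (s : Finset V) (c : V → ℝ), (∀ i, 0 ≤ c i) →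
        (∀ e, A.IsInfinitePath e → src (e 0) ∈ s → (fun k => lab (e k)) ∈ K) →
        ∃ μ : Measure K,
          (∀ w, μ (cylinder K w) = ENNReal.ofReal (∑ i ∈ s, c i * A.wordProb p w i)) ∧
          μ.map (digitMap β K) = ∑ i ∈ s, ENNReal.ofReal (c i) • ν i := by
  obtain ⟨P, X, hP, hX, hpath, hprob⟩ := exists_labelProcess A hp
  have hpos : ∀ {i e}, e ∈ A.outEdges i → 0 ≤ p e := fun he =>
    (hp.pos _ (A.mem_outEdges.1 he).1).le
  have hcons : ∀ e, Measurable fun ω => consSeq (lab e) (X (tgt e) ω) := fun e =>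
    (measurable_consSeq _).comp (hX _)
  -- Markov property at the first step, for laws of labels only; on cylinders it is the recursion
  -- defining `wordProb`.
  have hmarkov : ∀ i, P.map (X i) = ∑ e ∈ A.outEdges i,
      ENNReal.ofReal (p e) • P.map (fun ω => consSeq (lab e) (X (tgt e) ω)) := by
    intro i
    have := Measure.isProbabilityMeasure_map (μ := P) (hX i).aemeasurable
    refine ext_of_wordSet fun w => ?_
    have hms := measurableSet_wordSet w
    rw [Measure.map_apply (hX i) hms, hprob, Measure.finsetSum_apply]
    simp only [Measure.smul_apply, smul_eq_mul]
    simp only [Measure.map_apply (hcons _) hms]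
    cases w with
    | nil =>
      simp only [wordSet_nil, Set.preimage_univ, measure_univ, mul_one, wordProb]
      rw [← ENNReal.ofReal_sum_of_nonneg fun e he => hpos he, hp.sum_eq_one]
    | cons a w =>
      rw [wordProb, ENNReal.ofReal_sum_of_nonneg fun e he => mul_nonneg
        (hpos (Finset.mem_filter.1 he).1) (A.wordProb_nonneg hp _ _), Finset.sum_filter]
      refine Finset.sum_congr rfl fun e he => ?_
      split_ifs with hea
      · rw [ENNReal.ofReal_mul (hpos he), ← hprob]
        congr 2
        ext ω
        simp only [Set.mem_preimage, mem_wordSet_cons]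
        exact ⟨fun h => ⟨hea, h⟩, fun h => h.2⟩
      · have : (fun ω => consSeq (lab e) (X (tgt e) ω)) ⁻¹' wordSet (a :: w) = ∅ := by
          refine Set.eq_empty_of_forall_notMem fun ω hω => hea ?_
          exact (mem_wordSet_cons.1 hω).1
        rw [this, measure_empty, mul_zero]
  have hφX : ∀ i, Measurable fun ω => digitSum β (X i ω) := fun i =>
    (measurable_digitSum β).comp (hX i)
  refine ⟨fun i => P.map fun ω => digitSum β (X i ω),
    fun i => Measure.isProbabilityMeasure_map (hφX i).aemeasurable, fun i => ?_, ?_⟩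
  · have h1 : (P.map fun ω => digitSum β (X i ω)) = (P.map (X i)).map (digitSum β) :=
      (Measure.map_map (measurable_digitSum β) (hX i)).symm
    dsimp only
    rw [h1, hmarkov, Measure.map_finset_sum (measurable_digitSum β).aemeasurable]
    refine Finset.sum_congr rfl fun e _ => ?_
    rw [Measure.map_smul, Measure.map_map (measurable_digitSum β) (hcons e),
      Measure.map_map (measurable_digit_add _ _) (hφX _)]
    congr 2
    ext ω
    obtain ⟨f, hf, -, hfX⟩ := hpath (tgt e) ω
    refine digitSum_consSeq _ ?_
    simpa only [hfX] using hf.summable hβ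
  · intro K s c hc hK
    have hXK : ∀ i ∈ s, ∀ ω, X i ω ∈ K := fun i hi ω => by
      obtain ⟨e, he, hei, heX⟩ := hpath i ω
      rw [show X i ω = fun k => lab (e k) from funext heX]
      exact hK e he (hei ▸ hi)
    have hY : ∀ i : s, Measurable fun ω => (⟨X i ω, hXK i i.2 ω⟩ : K) := fun i =>
      (hX i).subtype_mk
    refine ⟨∑ i : s, ENNReal.ofReal (c i) • P.map fun ω => (⟨X i ω, hXK i i.2 ω⟩ : K),
      fun w => ?_, ?_⟩
    · have hcyl : MeasurableSet (cylinder K w) :=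
        measurable_subtype_coe (measurableSet_wordSet w)
      rw [Measure.finsetSum_apply,
        ENNReal.ofReal_sum_of_nonneg fun i _ => mul_nonneg (hc i) (A.wordProb_nonneg hp _ _),
        ← Finset.sum_coe_sort s]
      refine Finset.sum_congr rfl fun i _ => ?_
      rw [Measure.smul_apply, Measure.map_apply (hY i) hcyl, ENNReal.ofReal_mul (hc i), ← hprob]
      rfl
    · rw [Measure.map_finset_sum (measurable_digitMap β K).aemeasurable,
        ← Finset.sum_coe_sort s]
      refine Finset.sum_congr rfl fun i _ => ?_
      rw [Measure.map_smul, Measure.map_map (measurable_digitMap β K) (hY i)]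
      rfl

/-! ### Purity -/

/-- Purity of a mixture of the measures of a self-similar family. -/
theorem IsSelfSimilar.isPure_map {p : V × ℤ × V → ℝ} {β : ℝ} {ν : V → Measure ℝ}
    [∀ i, IsProbabilityMeasure (ν i)] (hν : A.IsSelfSimilar p β ν) (hp : A.IsTransition p)
    (hM : A.transitionMatrix.IsPrimitive) (hβ : 1 < β) (hβa : IsAlgebraic ℚ β)
    {K : Set (ℕ → ℤ)} (hK : K ⊆ A.shift) {s : Finset V} {c : V → ℝ} (hc : ∀ i, 0 ≤ c i)
    (hc1 : ∑ i ∈ s, c i = 1) {μ : Measure K}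
    (hμ : μ.map (digitMap β K) = ∑ i ∈ s, ENNReal.ofReal (c i) • ν i) :
    IsProbabilityMeasure (μ.map (digitMap β K)) ∧ IsPure (μ.map (digitMap β K)) ∧
      (IsPurelyAtomic (μ.map (digitMap β K)) →
        (Set.range (digitMap β A.shift)).Finite ∧
        (atoms (μ.map (digitMap β K))).encard ≤ (Fintype.card V : ℕ∞)) := by
  have happly : ∀ t, μ.map (digitMap β K) t = ∑ i ∈ s, ENNReal.ofReal (c i) * ν i t := fun t => by
    rw [hμ, Measure.finsetSum_apply]
    rfl
  have hnull : ∀ t, (∀ i, ν i t = 0) → μ.map (digitMap β K) t = 0 := fun t ht => by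
    rw [happly]
    exact Finset.sum_eq_zero fun i _ => by rw [ht, mul_zero]
  have hprob : IsProbabilityMeasure (μ.map (digitMap β K)) := by
    refine ⟨?_⟩
    simp only [happly, measure_univ, mul_one]
    rw [← ENNReal.ofReal_sum_of_nonneg fun i _ => hc i, hc1, ENNReal.ofReal_one]
  refine ⟨hprob, ?_⟩
  -- The split is on atoms of the whole family: the mixture need not charge every vertex.
  by_cases hat : ∃ i x, ν i {x} ≠ 0
  · obtain ⟨i, x, hix⟩ := hat
    obtain ⟨y, hy⟩ := hν.exists_value_of_atom hp hM hβ hix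
    have hrange : ∀ K' : Set (ℕ → ℤ), K' ⊆ A.shift → ∀ x, digitMap β K' x ∈ Set.range y := by
      rintro K' hK' ⟨x, hx⟩
      obtain ⟨e, he, hex⟩ := hK' hx
      refine ⟨src (e 0), ?_⟩
      rw [← (hy e he).tsum_eq]
      simp only [digitMap, hex]
    have hcompl : μ.map (digitMap β K) (Set.range y)ᶜ = 0 := by
      rw [Measure.map_apply (measurable_digitMap β K)
        (Set.finite_range y).measurableSet.compl]
      convert measure_empty (μ := μ)
      exact Set.eq_empty_of_forall_notMem fun x hx => hx (hrange K hK x)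
    refine ⟨Or.inr (Or.inr ⟨_, (Set.finite_range y).countable, hcompl⟩), fun _ => ⟨?_, ?_⟩⟩
    · refine (Set.finite_range y).subset ?_
      rintro _ ⟨x, rfl⟩
      exact hrange _ le_rfl x
    · have hsub : atoms (μ.map (digitMap β K)) ⊆ y '' Set.univ := by
        intro x hx
        rw [Set.image_univ]
        by_contra hxy
        exact hx (measure_mono_null (Set.singleton_subset_iff.2 hxy) hcompl)
      calc _ ≤ _ := Set.encard_le_encard hsub
        _ ≤ (Set.univ : Set V).encard := Set.encard_image_le _ _
        _ = _ := by simp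
  · push Not at hat
    have hna : ∀ x, μ.map (digitMap β K) {x} = 0 := fun x => hnull _ fun i => hat i x
    constructor
    · rcases hν.absolutelyContinuous_or_singular hp hM hβ hβa with hac | ⟨N, hN, hvN, hNν⟩
      · exact Or.inl fun t ht => hnull t fun i => hac i ht
      · exact Or.inr (Or.inl ⟨⟨Nᶜ, hN.compl, hnull _ hNν, by rwa [compl_compl]⟩, hna⟩)
    -- A probability measure without atoms is not carried by a countable set.
    · rintro ⟨S, hS, hSc⟩
      have : NullSingletonClass (μ.map (digitMap β K)) := ⟨hna⟩
      have h := measure_union_null (hS.measure_zero (μ.map (digitMap β K))) hSc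
      rw [Set.union_compl_self, measure_univ] at h
      exact absurd h one_ne_zero

end DigitAutomaton

/-! ### The purity theorem -/

theorem mainTheorem1 {V : Type*} [Fintype V] [DecidableEq V] (A : DigitAutomaton V)
    (hI : A.init.Nonempty) (hT : A.term.Nonempty) (hM : A.transitionMatrix.IsPrimitive)
    (β : ℝ) (hβ : IsPisot β) :
    (∃! μI : Measure A.shiftInit, A.IsInitMeasure μI) ∧
    (∃! μ : Measure A.shift, A.IsParryMeasure μ) ∧
    ∀ (μI : Measure A.shiftInit) (μ : Measure A.shift),
      A.IsInitMeasure μI → A.IsParryMeasure μ →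
      (A.Unambiguous → ∀ w : List ℤ,
        Tendsto (fun n : ℕ => ENNReal.ofReal ((A.wordCount w n : ℝ) / (A.wordCount [] n : ℝ)))
          atTop (𝓝 (μI (DigitAutomaton.cylinder A.shiftInit w)))) ∧
      ∀ ν ∈ ({μI.map (digitMap β A.shiftInit), μ.map (digitMap β A.shift)} : Set (Measure ℝ)),
        IsProbabilityMeasure ν ∧ IsPure ν ∧
        (IsPurelyAtomic ν →
          (Set.range (digitMap β A.shift)).Finite ∧
          (atoms ν).encard ≤ (Fintype.card V : ℕ∞)) := by
  classical
  have hβa : IsAlgebraic ℚ β := (hβ.2.1.tower_top (A := ℚ)).isAlgebraic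
  have : Nonempty V := hI.nonempty
  obtain ⟨lam, vL, vR, hP⟩ := DigitAutomaton.exists_isPerron hM
  have hp := hP.isTransition
  obtain ⟨ν, hνp, hν, hmix⟩ := hp.exists_selfSimilar hβ.1
  have hvI : 0 < ∑ i with i ∈ A.init, vR i := by
    obtain ⟨i, hi⟩ := hI
    exact Finset.sum_pos (fun i _ => hP.right_pos i) ⟨i, by simpa using hi⟩
  -- Initial distribution of the chain for μ_I⁺; the one for μ⁺ is `vL i * vR i`, of total mass one
  -- by the normalisation.
  have hcI : ∀ i, 0 ≤ vR i / ∑ i with i ∈ A.init, vR i := fun i =>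
    div_nonneg (hP.right_pos i).le hvI.le
  have hcI1 : ∑ i with i ∈ A.init, vR i / ∑ i with i ∈ A.init, vR i = 1 := by
    rw [← Finset.sum_div, div_self hvI.ne']
  have hc : ∀ i, 0 ≤ vL i * vR i := fun i => (mul_pos (hP.left_pos i) (hP.right_pos i)).le
  obtain ⟨μI₀, hμI₀, hμI₀m⟩ := hmix A.shiftInit (Finset.univ.filter (· ∈ A.init)) _ hcI
    fun e he hs => ⟨e, he, by simpa using hs, fun _ => rfl⟩
  obtain ⟨μ₀, hμ₀, hμ₀m⟩ := hmix A.shift Finset.univ _ hc fun e he _ => ⟨e, he, fun _ => rfl⟩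
  have hI₀ : A.IsInitMeasure μI₀ := fun w => by
    rw [hμI₀]
    refine (ENNReal.continuous_ofReal.tendsto _).comp ?_
    convert DigitAutomaton.tendsto_pathCount_div hI hT hM hP w using 2
    rw [Finset.mul_sum]
    refine Finset.sum_congr rfl fun i _ => ?_
    rw [div_mul_eq_mul_div, hP.mul_wordProb, mul_div_assoc]
  have hP₀ : ∀ w, μ₀ (DigitAutomaton.cylinder A.shift w) = ENNReal.ofReal
      ((lam ^ w.length)⁻¹ * dotProduct vL (Matrix.mulVec (A.wordMatrix w) vR)) := fun w => by
    rw [hμ₀, dotProduct, Finset.mul_sum]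
    congr 1
    refine Finset.sum_congr rfl fun i _ => ?_
    rw [mul_assoc, hP.mul_wordProb, mul_left_comm]
  have hfinI : IsFiniteMeasure μI₀ := DigitAutomaton.isFiniteMeasure_of_cylinder (hμI₀ [])
  have hfin : IsFiniteMeasure μ₀ := DigitAutomaton.isFiniteMeasure_of_cylinder (hμ₀ [])
  have huI : ∀ μI, A.IsInitMeasure μI → μI = μI₀ := fun μI h =>
    (DigitAutomaton.ext_of_cylinder fun w => tendsto_nhds_unique (hI₀ w) (h w)).symm
  have hu : ∀ μ, A.IsParryMeasure μ → μ = μ₀ := by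
    rintro μ ⟨lam', vL', vR', hP', h⟩
    refine (DigitAutomaton.ext_of_cylinder fun w => ?_).symm
    rw [hP₀, h, hP.eigenvalue_unique hP', hP.dotProduct_unique hM hP']
  refine ⟨⟨μI₀, hI₀, huI⟩, ⟨μ₀, ⟨lam, vL, vR, hP, hP₀⟩, hu⟩, fun μI μ hμI hμ => ⟨?_, ?_⟩⟩
  · intro hA w
    refine (hμI w).congr' ?_
    filter_upwards [eventually_ne_atTop 0] with n hn
    rw [A.wordCount_eq_pathCount hA w hn, A.wordCount_eq_pathCount hA [] hn]
  · obtain rfl := huI μI hμI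
    obtain rfl := hu μ hμ
    rintro _ (rfl | rfl)
    · refine hν.isPure_map hp hM hβ.1 hβa ?_ hcI hcI1 hμI₀m
      rintro x ⟨e, he, -, hx⟩
      exact ⟨e, he, hx⟩
    · exact hν.isPure_map hp hM hβ.1 hβa le_rfl hc hP.normalised hμ₀m
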